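/- A deck of $n$ cards, numbered $1,\dots,n$, is laid out in a row in increasing order. Each card is removed and reinserted exactly once, in the order $1,2,\dots,n$; every reinsertion is into one of the $n$ positions, chosen uniformly and independently of the others. Let $p_n$ be the resulting probability, $\sigma_k$ the number of the card finally in position $k$, and $\sigma^{-1}_j$ the final position of card $j$. For $b,x\in[0,1]$ and every sequence of integers $1\le j_n\le n$ with $j_n/n\to b$, the limit $$F_b(x)=\lim_{n\to\infty}p_n(\sigma^{-1}_{j_n}\le xn)$$ exists and depends only on $b$ and $x$. Put $x_b=e^{1-b}-(1-b)e$. On $[0,1]$ the function $F_b$ is differentiable (one-sidedly at the end points) at every $x\ne x_b$, and its derivative $f_b$ is integrable with $\int_0^xf_b(t)\,dt=F_b(x)$; that is, $f_b$ is the density of the limiting rescaled position of a card with a number around $bn$. Put $h_x(b)=f_b(x)$. Then $h_x$ is the density of the limiting rescaled number of the card occupying a position around $xn$, in the following sense: if $K_{n,\varepsilon}$ is uniformly distributed on the positions $k\in\{1,\dots,n\}$ with $|k/n-x|\le\varepsilon$, independently of the shuffle, then, when first $n\to\infty$ and then $\varepsilon\to0^+$, the law of $\sigma_{K_{n,\varepsilon}}/n$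 converges weakly to $h_x(b)\,db$ on $[0,1]$ if $0<x\le1$, and to $h_0(b)\,db+e^{-1}\delta_0$ if $x=0$. The functions $h_x$ have the following form. For $x=0$, one has $h_0(b)=e^{b-1}$ for $0<b\le1$. This is a sub-probability density of total mass $1-e^{-1}$, and, as stated, the limiting law has in addition an atom of mass $e^{-1}$ at $b=0$. For $x=1$, one has $h_1(b)=\frac{e^b}{e-1}$ for $0\le b<1$, and $\lim_{b\to1^-}h_1(b)=\frac e{e-1}$. The map $b\mapsto x_b$ is a bijection of $[0,1)$ onto itself; let $x\mapsto b_x$ denote its inverse. For $0<x<1$: i. $h_x(0)=\frac{e^{b_x-1}}{e^{b_x}-1}$; ii. $h_x$ is (strictly) increasing and convex on $0<b<b_x$; iii. $h_x(b_x^-)=\frac{e^{b_x-1}}{1-e^{-b_x}}$; iv. $h_x(b)=e^{b-1}$ for $b_x<b\le1$. -/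

import Mathlib

open Set Filter Topology MeasureTheory

noncomputable section

namespace CardCyclic

/-- One way of implementing the shuffle of a deck of `n` cards, numbered `1, …, n` and laid out in a
row. The deck starts in the order `1, 2, …, n`; for `c = 1, 2, …, n` in turn, card `c` is removed and
reinserted so that its position is `w (c - 1)` (positions counted from `0` here). The value is the
final row of cards, read from left to right. -/
def finalDeck (n : ℕ) (w : Fin n → Fin n) : List ℕ :=
  (List.finRange n).foldl
    (fun deck i => (deck.erase (i.val + 1)).insertIdx (w i).val (i.val + 1))
    (List.range' 1 n)

/-- The probability, under the card-cyclic to random insertion shuffle started from the identity,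
that the final deck satisfies `A`: the `n ^ n` choices of reinsertion positions are equally likely. -/
def shuffleProb (n : ℕ) (A : List ℕ → Prop) : ℝ :=
  (Nat.card {w : Fin n → Fin n // A (finalDeck n w)} : ℝ) / (n : ℝ) ^ n

/-- The position (counted from `1`) of card `j` in a deck. -/
def position (deck : List ℕ) (j : ℕ) : ℕ := deck.idxOf j + 1

/-- The number of the card in position `k` of a deck (positions counted from `1`). -/
def cardAt (deck : List ℕ) (k : ℕ) : ℕ := deck.getD (k - 1) 0

/-- The probability that card number `j` ends up in a position that is at most `x * n`. -/
def positionProb (n j : ℕ) (x : ℝ) : ℝ :=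
  shuffleProb n (fun deck => (position deck j : ℝ) ≤ x * n)

/-- `F_b(x)`: the limit, as `n → ∞`, of the probability that a card with a number around `b * n` ends
up in a position that is at most `x * n`. The sequence of card numbers used here is one with
`j n / n → b`. -/
def positionCDF (b x : ℝ) : ℝ :=
  limUnder atTop (fun n : ℕ => positionProb n (max 1 ⌈b * n⌉₊) x)

/-- `f_b(x)`: the density of the limiting rescaled position of a card with a number around `b * n`,
that is, the derivative of `F_b` on `[0, 1]` (one-sided at the two end points). -/
def positionDensity (b x : ℝ) : ℝ := derivWithin (positionCDF b) (Icc 0 1) x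

/-- `h_x(b) = f_b(x)`. -/
def cardDensity (x b : ℝ) : ℝ := positionDensity b x

/-- The function `b ↦ x_b = e ^ (1 - b) - (1 - b) * e`. -/
def xOf (b : ℝ) : ℝ := Real.exp (1 - b) - (1 - b) * Real.exp 1

/-- The function `x ↦ b_x` on `[0, 1)`, inverse to `b ↦ x_b` on `[0, 1)`. -/
def bOf (x : ℝ) : ℝ := Function.invFunOn xOf (Ico 0 1) x

open Classical in
/-- The positions of a deck of `n` cards at rescaled distance at most `ε` from `x`. -/
def window (n : ℕ) (x ε : ℝ) : Finset ℕ :=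
  (Finset.Icc 1 n).filter (fun k => |(k : ℝ) / n - x| ≤ ε)

/-- The probability that the card that occupies a position chosen uniformly from the window of
half-width `ε * n` around `x * n`, independently of the shuffle, has a number that is at most
`b * n`. -/
def windowCDF (n : ℕ) (x ε b : ℝ) : ℝ :=
  (∑ k ∈ window n x ε, shuffleProb n (fun deck => (cardAt deck k : ℝ) ≤ b * n)) /
    ((window n x ε).card : ℝ)

/-- `μ` is the limiting law of the rescaled number of the card that occupies a position around
`x * n`: the law of the rescaled number of the card in a uniformly chosen position of the window of
half-width `ε * n` around `x * n` converges weakly to `μ` when first `n → ∞` and then `ε → 0`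
(convergence of distribution functions at the points that are not atoms of `μ`). -/
def IsLimitingCardLaw (x : ℝ) (μ : Measure ℝ) : Prop :=
  IsProbabilityMeasure μ ∧
    ∀ b : ℝ, μ {b} = 0 → ∀ η > 0, ∃ ε₀ > 0, ∀ ε ∈ Ioo 0 ε₀, ∀ᶠ n : ℕ in atTop,
      |windowCDF n x ε b - μ.real (Iic b)| < η

/-- The measure `h_x(b) db` on `[0, 1]`. -/
def densityMeasure (x : ℝ) : Measure ℝ :=
  (volume.restrict (Icc 0 1)).withDensity (fun b => ENNReal.ofReal (cardDensity x b))

end CardCyclic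

end

namespace CardCyclic

/-! ### The deck and a marker in it -/

/-! Lay a marker behind card `m` and follow the number `M` of cards ahead of it. Card `t + 1` lies
ahead of the marker before its move exactly if `t < m`, and a removed card falls ahead of the marker
with probability `(g + 1) / n`, where `g` is the number of cards left ahead of it. So `M` is a
Markov chain whose mean obeys an affine recursion that can be solved exactly (`meanMarker_eq`), and
whose variance is `O(n)` (`mean_sq_marker_sub_le`). With `m ≈ βn`, the rescaled marker at time `bn`
is therefore close to `flow b β`; at the end it is close to `flow 1 β = xOf β`. This is the origin
of `x_b`. Every card moves once, so card `j` finishes ahead of the marker iff it is reinserted ahead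
of it (`position_le_marker_iff`). For `j ≈ bn` the probability of this tends to `flow b β`. The
marker that finishes at `xn` starts at `β = xInv x`, so trapping `xn` between two nearby markers
yields `F_b(x) = flow b (xInv x)` (`tendsto_positionProb`). This is linear in `x` below `x_b` and
involves `xInv` above it; differentiation gives the formulas for `h_x`. For the law of the card in a
given position, count the cards with number at most `J` ahead of the final marker: there are `M_J -
(m - J)⁺` of them (`card_cardAt_le_marker`). Hence the proportion of the deck made up of cards
numbered at most `bn` in positions at most `xn` tends to `jointCDF b x`. A window average is a
difference quotient of this function in `x`, so it tends to the `x`-derivative `cardCDF x b`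
(`hasDerivWithinAt_jointCDF`, `exists_abs_slope_sub_lt`), and the `b`-derivative of `cardCDF x` is
`h_x` (`hasDerivAt_cardCDF`). For `x = 0` the function `cardCDF 0` jumps by `e⁻¹` at `b = 0`, which
is the atom. -/

theorem insertIdx_append_left {c : ℕ} :
    ∀ {A B : List ℕ} {i : ℕ}, i ≤ A.length → (A ++ B).insertIdx i c = A.insertIdx i c ++ B
  | A, B, 0, _ => by simp
  | [], B, i + 1, h => by simp at h
  | a :: A, B, i + 1, h => by
      simp only [List.cons_append, List.insertIdx_succ_cons, List.cons.injEq, true_and]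
      exact insertIdx_append_left (by simpa using h)

theorem insertIdx_append_right {c : ℕ} :
    ∀ {A B : List ℕ} {i : ℕ}, A.length ≤ i →
      (A ++ B).insertIdx i c = A ++ B.insertIdx (i - A.length) c
  | [], B, i, _ => by simp
  | a :: A, B, 0, h => by simp at h
  | a :: A, B, i + 1, h => by
      simp only [List.cons_append, List.insertIdx_succ_cons, List.length_cons, List.cons.injEq,
        true_and, Nat.add_sub_add_right]
      exact insertIdx_append_right (by simpa using h)

/-- The marker is the cut between `A` and `B`. Insertion exactly at the cut, `i = A.length`, is
counted as ahead of it; this tie rule produces the `+ 1` in the probability `(g + 1) / n`. -/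
theorem exists_split_insertIdx (A B : List ℕ) {c : ℕ} (hA : c ∉ A) (i : ℕ) :
    ∃ A' B' : List ℕ, (A ++ B).insertIdx i c = A' ++ B' ∧
      A'.length = A.length + (if i ≤ A.length then 1 else 0) ∧
      ∀ x, x ∈ A' ↔ if x = c then i ≤ A.length else x ∈ A := by
  by_cases h : i ≤ A.length
  · refine ⟨A.insertIdx i c, B, insertIdx_append_left h, ?_, fun x => ?_⟩
    · simp [h, List.length_insertIdx]
    · rw [List.mem_insertIdx h]
      split_ifs with hx <;> simp [hx, h]
  · refine ⟨A, B.insertIdx (i - A.length) c, insertIdx_append_right (by omega), by simp [h], ?_⟩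
    intro x
    split_ifs with hx
    · subst hx; simp [hA, h]
    · rfl

theorem exists_split_move {A B : List ℕ} {c : ℕ} (hnd : (A ++ B).Nodup) (i : ℕ) {g : ℕ}
    (hg : g = if c ∈ A then A.length - 1 else A.length) :
    ∃ A' B' : List ℕ, ((A ++ B).erase c).insertIdx i c = A' ++ B' ∧
      A'.length = g + (if i ≤ g then 1 else 0) ∧
      ∀ x, x ∈ A' ↔ if x = c then i ≤ g else x ∈ A := by
  have hA : A.Nodup := (List.nodup_append.1 hnd).1
  by_cases hc : c ∈ A
  · rw [List.erase_append_left _ hc]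
    have hl : (A.erase c).length = g := by rw [List.length_erase_of_mem hc, hg, if_pos hc]
    obtain ⟨A', B', h1, h2, h3⟩ :=
      exists_split_insertIdx (A.erase c) B (c := c) (by simp [hA.mem_erase_iff]) i
    rw [hl] at h2 h3
    refine ⟨A', B', h1, h2, fun x => ?_⟩
    rw [h3 x]
    split_ifs with hx
    · rfl
    · simp [hA.mem_erase_iff, hx]
  · rw [List.erase_append_right _ hc]
    have hl : A.length = g := by rw [hg, if_neg hc]
    obtain ⟨A', B', h1, h2, h3⟩ := exists_split_insertIdx A (B.erase c) hc i
    rw [hl] at h2 h3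
    exact ⟨A', B', h1, h2, h3⟩

/-- The deck after the first `t` cards have been moved. -/
def deckAt (n : ℕ) (w : Fin n → Fin n) (t : ℕ) : List ℕ :=
  ((List.finRange n).take t).foldl
    (fun deck i => (deck.erase (i.val + 1)).insertIdx (w i).val (i.val + 1))
    (List.range' 1 n)

/-- The position chosen for the `t`-th reinsertion, counted from `0`. -/
def insertPos {n : ℕ} (w : Fin n → Fin n) (t : ℕ) : ℕ := if h : t < n then (w ⟨t, h⟩).val else 0

/-- The number of cards ahead of the marker after the removal of card `t + 1`, if there were `M`
before it and if the marker was laid behind card `m`. -/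
def gap (m t M : ℕ) : ℕ := if t < m then M - 1 else M

/-- The number of cards ahead of a marker that is laid behind card `m` at the start, after the first
`t` cards have been moved. A card that is reinserted where the marker lies goes ahead of it. -/
def marker (m : ℕ) {n : ℕ} (w : Fin n → Fin n) : ℕ → ℕ
  | 0 => m
  | t + 1 => gap m t (marker m w t) + if insertPos w t ≤ gap m t (marker m w t) then 1 else 0

/-- Card `t + 1` is reinserted ahead of the marker. -/
def GoesAhead (m : ℕ) {n : ℕ} (w : Fin n → Fin n) (t : ℕ) : Prop :=
  insertPos w t ≤ gap m t (marker m w t)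

theorem deckAt_zero (n : ℕ) (w : Fin n → Fin n) : deckAt n w 0 = List.range' 1 n := by
  simp [deckAt]

theorem deckAt_succ {n : ℕ} (w : Fin n → Fin n) {t : ℕ} (ht : t < n) :
    deckAt n w (t + 1) = ((deckAt n w t).erase (t + 1)).insertIdx (insertPos w t) (t + 1) := by
  have : (List.finRange n).take (t + 1) = (List.finRange n).take t ++ [⟨t, ht⟩] := by
    rw [List.take_add_one]
    simp [ht]
  simp [deckAt, this, insertPos, ht]

theorem deckAt_self (n : ℕ) (w : Fin n → Fin n) : deckAt n w n = finalDeck n w := by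
  simp [deckAt, finalDeck, List.take_of_length_le]

theorem insertPos_lt {n : ℕ} (w : Fin n → Fin n) {t : ℕ} (ht : t < n) : insertPos w t < n := by
  simp [insertPos, ht]

theorem deckAt_perm {n : ℕ} (w : Fin n → Fin n) {t : ℕ} (ht : t ≤ n) :
    (deckAt n w t).Perm (List.range' 1 n) := by
  induction t with
  | zero => rw [deckAt_zero]
  | succ t ih =>
    have ih := ih (by omega)
    have hmem : t + 1 ∈ deckAt n w t := by
      rw [ih.mem_iff, List.mem_range'_1]; omega
    rw [deckAt_succ w (by omega)]
    have hlen : (deckAt n w t).length = n := by simpa using ih.length_eq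
    have hi := insertPos_lt w (t := t) (by omega)
    refine (List.perm_insertIdx _ _ ?_).trans ((List.perm_cons_erase hmem).symm.trans ih)
    rw [List.length_erase_of_mem hmem]; omega

theorem finalDeck_perm {n : ℕ} (w : Fin n → Fin n) :
    (finalDeck n w).Perm (List.range' 1 n) := deckAt_self n w ▸ deckAt_perm w le_rfl

/-- The invariant that ties the list to the chain `marker`: the side of a moved card was fixed at
its reinsertion, that of an unmoved card by the initial order. -/
theorem exists_split_deckAt {n m : ℕ} (hm : m ≤ n) (w : Fin n → Fin n) {t : ℕ} (ht : t ≤ n) :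
    ∃ A B : List ℕ, deckAt n w t = A ++ B ∧ A.length = marker m w t ∧
      ∀ x, 1 ≤ x → x ≤ n → (x ∈ A ↔ if x ≤ t then GoesAhead m w (x - 1) else x ≤ m) := by
  induction t with
  | zero =>
    refine ⟨List.range' 1 m, List.range' (1 + m) (n - m), ?_, by simp [marker], ?_⟩
    · rw [deckAt_zero, List.range'_append_1]; congr 1; omega
    · intro x h1 h2
      rw [List.mem_range'_1, if_neg (by omega)]; omega
  | succ t ih =>
    obtain ⟨A, B, h1, h2, h3⟩ := ih (by omega)
    have hnd : (A ++ B).Nodup := by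
      rw [← h1, (deckAt_perm w (t := t) (by omega)).nodup_iff]; exact List.nodup_range'
    have hmem : t + 1 ∈ A ↔ t < m := by
      rw [h3 (t + 1) (by omega) ht, if_neg (by omega)]; omega
    obtain ⟨A', B', k1, k2, k3⟩ := exists_split_move (c := t + 1) hnd (insertPos w t)
      (g := gap m t (marker m w t)) (by simp only [hmem, h2, gap])
    refine ⟨A', B', by rw [deckAt_succ w (by omega), h1, k1], k2, fun x hx1 hx2 => ?_⟩
    rw [k3 x]
    by_cases hx : x = t + 1
    · subst hx; simp [GoesAhead]
    · rw [if_neg hx, h3 x hx1 hx2]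
      by_cases hxt : x ≤ t
      · rw [if_pos hxt, if_pos (by omega)]
      · rw [if_neg hxt, if_neg (by omega)]

/-- A card ends up ahead of the marker exactly if it is reinserted ahead of it. -/
theorem position_le_marker_iff {n m : ℕ} (hm : m ≤ n) (w : Fin n → Fin n) {j : ℕ} (h1 : 1 ≤ j)
    (hj : j ≤ n) :
    position (finalDeck n w) j ≤ marker m w n ↔ GoesAhead m w (j - 1) := by
  obtain ⟨A, B, k1, k2, k3⟩ := exists_split_deckAt hm w (le_refl n)
  have := k3 j h1 hj
  rw [if_pos hj] at this
  rw [← this, ← deckAt_self, k1, ← k2, position]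
  by_cases h : j ∈ A
  · simp only [h, iff_true, List.idxOf_append_of_mem h]
    exact List.idxOf_lt_length_iff.2 h
  · simp only [h, iff_false, List.idxOf_append_of_notMem h]
    omega

open Classical in
/-- The marker has ahead of it the cards reinserted there and the unmoved ones laid ahead of it. -/
theorem marker_eq_card_add {n m : ℕ} (w : Fin n → Fin n) (t : ℕ) :
    marker m w t = ((Finset.range t).filter (GoesAhead m w)).card + (m - t) := by
  induction t with
  | zero => simp [marker]
  | succ t ih =>
    rw [marker, Finset.range_add_one, Finset.filter_insert]
    have hg : gap m t (marker m w t) =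
        ((Finset.range t).filter (GoesAhead m w)).card + (m - (t + 1)) := by
      unfold gap; rw [ih]; split_ifs <;> omega
    by_cases h : GoesAhead m w t
    · rw [if_pos h, Finset.card_insert_of_notMem (by simp), if_pos (show _ ≤ _ from h), hg]
      omega
    · rw [if_neg h, if_neg (show ¬ (_ ≤ _) from h), hg]; rfl

theorem marker_le {n m : ℕ} (w : Fin n → Fin n) (t : ℕ) : marker m w t ≤ max t m := by
  classical
  rw [marker_eq_card_add]
  have := Finset.card_filter_le (Finset.range t) (GoesAhead m w)
  rw [Finset.card_range] at this
  omega

/-- The unmoved cards numbered at most `m` are all still ahead. In particular the truncated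
subtraction in `gap` is exact. -/
theorem le_marker {n m : ℕ} (w : Fin n → Fin n) (t : ℕ) : m - t ≤ marker m w t := by
  rw [marker_eq_card_add]
  omega

/-- Ensures that exactly `gap + 1` of the `n` insertion positions lie ahead of the marker. -/
theorem gap_lt {n m t : ℕ} (hm : m ≤ n) (w : Fin n → Fin n) (ht : t < n) :
    gap m t (marker m w t) < n := by
  have h1 := marker_le (m := m) w t
  have h2 := le_marker (m := m) w t
  unfold gap
  split_ifs <;> omega

/-- Counting cards in the first `K` positions by position and by number. -/
theorem card_cardAt_eq_card_position {n : ℕ} {d : List ℕ} (hd : d.Perm (List.range' 1 n))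
    {K J : ℕ} (hK : K ≤ n) (hJ : J ≤ n) :
    ((Finset.Icc 1 K).filter (fun k => cardAt d k ≤ J)).card =
      ((Finset.Icc 1 J).filter (fun j => position d j ≤ K)).card := by
  have hnd : d.Nodup := hd.nodup_iff.2 List.nodup_range'
  have hlen : d.length = n := by simpa using hd.length_eq
  have hmem : ∀ x, x ∈ d ↔ 1 ≤ x ∧ x ≤ n := fun x => by
    rw [hd.mem_iff, List.mem_range'_1]; omega
  refine Finset.card_nbij' (cardAt d) (position d) ?_ ?_ ?_ ?_
  · intro k hk
    simp only [Finset.coe_filter, Finset.mem_Icc, mem_ofPred_eq] at hk ⊢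
    have hk' : k - 1 < d.length := by omega
    have h1 : cardAt d k = d[k - 1] := by simp [cardAt, hk']
    have h2 := (hmem d[k - 1]).1 (List.getElem_mem hk')
    refine ⟨⟨by omega, hk.2⟩, ?_⟩
    rw [h1, position, hnd.idxOf_getElem]; omega
  · intro j hj
    simp only [Finset.coe_filter, Finset.mem_Icc, mem_ofPred_eq] at hj ⊢
    have hj' : d.idxOf j < d.length := List.idxOf_lt_length_iff.2 ((hmem j).2 (by omega))
    refine ⟨⟨by simp [position], hj.2⟩, ?_⟩
    have : cardAt d (position d j) = j := by simp [cardAt, position, hj']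
    omega
  · intro k hk
    simp only [Finset.coe_filter, Finset.mem_Icc, mem_ofPred_eq] at hk ⊢
    have hk' : k - 1 < d.length := by omega
    have h1 : cardAt d k = d[k - 1] := by simp [cardAt, hk']
    rw [h1, position, hnd.idxOf_getElem]; omega
  · intro j hj
    simp only [Finset.coe_filter, Finset.mem_Icc, mem_ofPred_eq] at hj ⊢
    have hj' : d.idxOf j < d.length := List.idxOf_lt_length_iff.2 ((hmem j).2 (by omega))
    simp [cardAt, position, hj']

/-- The number of cards among the first `J` that end up ahead of the marker. -/
theorem card_cardAt_le_marker {n m J : ℕ} (hm : m ≤ n) (hJ : J ≤ n) (w : Fin n → Fin n) :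
    ((Finset.Icc 1 (marker m w n)).filter (fun k => cardAt (finalDeck n w) k ≤ J)).card + (m - J) =
      marker m w J := by
  classical
  -- Both sides now count, among the first `J` cards, those that went ahead of the marker; the
  -- marker at time `J` has besides them only the `m - J` unmoved cards. Card `j` is moved at time
  -- `j - 1`, whence the shift.
  rw [card_cardAt_eq_card_position (finalDeck_perm w) ((marker_le w n).trans (by simp [hm])) hJ,
    marker_eq_card_add w J]
  congr 1
  refine Finset.card_nbij' (fun j => j - 1) (fun t => t + 1) ?_ ?_ ?_ ?_
  · intro j hj
    simp only [Finset.coe_filter, Finset.mem_Icc, mem_ofPred_eq, Finset.mem_range] at hj ⊢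
    exact ⟨by omega, (position_le_marker_iff hm w hj.1.1 (by omega)).1 hj.2⟩
  · intro t ht
    simp only [Finset.coe_filter, Finset.mem_Icc, mem_ofPred_eq, Finset.mem_range] at ht ⊢
    exact ⟨by omega, (position_le_marker_iff hm w (by omega) (by omega)).2 ht.2⟩
  · intro j hj
    simp only [Finset.coe_filter, Finset.mem_Icc, mem_ofPred_eq] at hj ⊢
    omega
  · intro t _
    simp

/-! ### Averages over the shuffles -/

/-- The average over all choices of reinsertion positions. -/
noncomputable def mean (n : ℕ) (f : (Fin n → Fin n) → ℝ) : ℝ := (∑ w, f w) / (n : ℝ) ^ n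

section mean

variable {n : ℕ}

theorem mean_add (f g : (Fin n → Fin n) → ℝ) :
    mean n (fun w => f w + g w) = mean n f + mean n g := by
  simp [mean, Finset.sum_add_distrib, add_div]

theorem mean_sub (f g : (Fin n → Fin n) → ℝ) :
    mean n (fun w => f w - g w) = mean n f - mean n g := by
  simp [mean, Finset.sum_sub_distrib, sub_div]

theorem mean_const_mul (c : ℝ) (f : (Fin n → Fin n) → ℝ) :
    mean n (fun w => c * f w) = c * mean n f := by
  simp [mean, ← Finset.mul_sum, mul_div_assoc]

theorem mean_div_const (f : (Fin n → Fin n) → ℝ) (c : ℝ) :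
    mean n (fun w => f w / c) = mean n f / c := by
  simp [mean, ← Finset.sum_div, div_right_comm]

theorem mean_sum {ι : Type*} (s : Finset ι) (f : ι → (Fin n → Fin n) → ℝ) :
    mean n (fun w => ∑ i ∈ s, f i w) = ∑ i ∈ s, mean n (f i) := by
  simp only [mean, ← Finset.sum_div]
  rw [Finset.sum_comm]

theorem mean_mono {f g : (Fin n → Fin n) → ℝ} (h : ∀ w, f w ≤ g w) : mean n f ≤ mean n g :=
  div_le_div_of_nonneg_right (Finset.sum_le_sum fun w _ => h w) (by positivity)

theorem mean_nonneg {f : (Fin n → Fin n) → ℝ} (h : ∀ w, 0 ≤ f w) : 0 ≤ mean n f :=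
  div_nonneg (Finset.sum_nonneg fun w _ => h w) (by positivity)

theorem mean_const (hn : 0 < n) (c : ℝ) : mean n (fun _ => c) = c := by
  have : (n : ℝ) ^ n ≠ 0 := by positivity
  simp [mean, this]

theorem abs_mean_le (f : (Fin n → Fin n) → ℝ) : |mean n f| ≤ mean n (fun w => |f w|) := by
  rw [mean, abs_div, abs_of_nonneg (show (0 : ℝ) ≤ (n : ℝ) ^ n by positivity)]
  exact div_le_div_of_nonneg_right (Finset.abs_sum_le_sum_abs _ _) (by positivity)

open Classical in
theorem shuffleProb_eq_mean (A : List ℕ → Prop) :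
    shuffleProb n A = mean n (fun w => if A (finalDeck n w) then 1 else 0) := by
  simp only [shuffleProb, mean, Finset.sum_boole, Nat.card_eq_fintype_card, Fintype.card_subtype]

theorem mean_abs_le {f : (Fin n → Fin n) → ℝ} (hn : 0 < n) {c : ℝ} (hc : 0 < c) :
    mean n (fun w => |f w|) ≤ (mean n (fun w => f w ^ 2) / c + c) / 2 := by
  have h : ∀ w, |f w| ≤ (f w ^ 2 / c + c) / 2 := fun w => by
    rw [div_add' _ _ _ hc.ne', div_div, le_div_iff₀ (by positivity)]
    nlinarith [sq_nonneg (|f w| - c), sq_abs (f w)]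
  refine (mean_mono h).trans_eq ?_
  rw [mean_div_const, mean_add, mean_div_const, mean_const hn]

/-- Markov's inequality. -/
theorem mean_indicator_le {f : (Fin n → Fin n) → ℝ} {A : (Fin n → Fin n) → Prop} [DecidablePred A]
    (h0 : ∀ w, 0 ≤ f w) {c : ℝ} (hc : 0 < c) (h : ∀ w, A w → c ≤ f w) :
    mean n (fun w => if A w then 1 else 0) ≤ mean n f / c := by
  rw [← mean_div_const]
  refine mean_mono fun w => ?_
  split_ifs with hw
  · rw [le_div_iff₀ hc, one_mul]; exact h w hw
  · exact div_nonneg (h0 w) hc.le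

/-- A coordinate of which the rest of the integrand is independent can be averaged out. -/
theorem mean_coordinate (hn : 0 < n) (t : Fin n) (φ : (Fin n → Fin n) → Fin n → ℝ)
    (hφ : ∀ w a b, φ (Function.update w t a) b = φ w b) :
    mean n (fun w => φ w (w t)) = mean n (fun w => (∑ a, φ w a) / n) := by
  have key : ∑ w : Fin n → Fin n, ∑ a, φ w a = n * ∑ w : Fin n → Fin n, φ w (w t) := by
    -- Exchanging the value at `t` with a fresh independent one is a measure-preserving involution.
    let e : (Fin n → Fin n) × Fin n → (Fin n → Fin n) × Fin n :=
      fun p => (Function.update p.1 t p.2, p.1 t)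
    have he : Function.Involutive e := fun p => by simp [e]
    calc ∑ w : Fin n → Fin n, ∑ a, φ w a = ∑ p : (Fin n → Fin n) × Fin n, φ p.1 p.2 :=
          (Fintype.sum_prod_type' _).symm
      _ = ∑ p : (Fin n → Fin n) × Fin n, φ (e p).1 (e p).2 :=
          (Equiv.sum_comp he.toPerm (fun p => φ p.1 p.2)).symm
      _ = ∑ p : (Fin n → Fin n) × Fin n, φ p.1 (p.1 t) := by simp [e, hφ]
      _ = ∑ w : Fin n → Fin n, ∑ _a : Fin n, φ w (w t) :=
          Fintype.sum_prod_type' (fun w (_ : Fin n) => φ w (w t))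
      _ = n * ∑ w : Fin n → Fin n, φ w (w t) := by simp [Finset.mul_sum]
  have hn' : (n : ℝ) ≠ 0 := by positivity
  simp only [mean]
  rw [← Finset.sum_div, key, mul_div_cancel_left₀ _ hn']

end mean

/-! ### Moments of the marker -/

theorem insertPos_update_of_lt {n : ℕ} (w : Fin n → Fin n) (t : Fin n) (a : Fin n) {s : ℕ}
    (hs : s < t) : insertPos (Function.update w t a) s = insertPos w s := by
  have h : s < n := hs.trans t.2
  simp only [insertPos, h, dif_pos]
  rw [Function.update_of_ne]
  exact Fin.ne_of_val_ne (by simpa using hs.ne)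

/-- Adaptedness: the marker up to time `t` depends only on the earlier choices, so it is independent
of `w t`. -/
theorem marker_update {n : ℕ} (m : ℕ) (w : Fin n → Fin n) (t : Fin n) (a : Fin n) {s : ℕ}
    (hs : s ≤ t) : marker m (Function.update w t a) s = marker m w s := by
  induction s with
  | zero => rfl
  | succ s ih => rw [marker, marker, ih (by omega), insertPos_update_of_lt w t a (by omega)]

open Classical in
-- The Markov property. The test function `ψ` is left free so that the mean, the probability of
-- going ahead and the second moment all come from this one identity.
theorem mean_step {n m t : ℕ} (hm : m ≤ n) (ht : t < n) (ψ : ℕ → ℝ → ℝ) :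
    mean n (fun w => ψ (gap m t (marker m w t)) (if GoesAhead m w t then 1 else 0)) =
      mean n (fun w => ((gap m t (marker m w t) : ℝ) + 1) / n * ψ (gap m t (marker m w t)) 1 +
        (1 - ((gap m t (marker m w t) : ℝ) + 1) / n) * ψ (gap m t (marker m w t)) 0) := by
  have hn : 0 < n := by omega
  have hn' : (n : ℝ) ≠ 0 := by positivity
  have h := mean_coordinate hn ⟨t, ht⟩
    (fun w a => ψ (gap m t (marker m w t)) (if a.val ≤ gap m t (marker m w t) then 1 else 0))
    (fun w a b => by simp only [marker_update m w ⟨t, ht⟩ a (le_refl t)])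
  simp only [GoesAhead, insertPos, ht, dif_pos]
  refine h.trans ?_
  congr 1
  funext w
  have hg := gap_lt hm w ht
  generalize gap m t (marker m w t) = g at *
  have hsum : ∑ a : Fin n, ψ g (if a.val ≤ g then 1 else 0) =
      ((g : ℝ) + 1) * ψ g 1 + (n - ((g : ℝ) + 1)) * ψ g 0 := by
    rw [Fin.sum_univ_eq_sum_range (fun a => ψ g (if a ≤ g then 1 else 0)) n,
      ← Finset.sum_range_add_sum_Ico _ (show g + 1 ≤ n by omega)]
    rw [Finset.sum_congr rfl (g := fun _ => ψ g 1)
      (fun a ha => by rw [if_pos (by have := Finset.mem_range.1 ha; omega)]),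
      Finset.sum_congr (s₁ := Finset.Ico (g + 1) n) rfl (g := fun _ => ψ g 0)
      (fun a ha => by rw [if_neg (by have := Finset.mem_Ico.1 ha; omega)])]
    have : ((n - (g + 1) : ℕ) : ℝ) = n - ((g : ℝ) + 1) := by
      rw [Nat.cast_sub (by omega)]; push_cast; rfl
    simp [this]
  rw [hsum]
  field_simp

/-- The mean of `gap` in terms of the mean of the marker. -/
noncomputable def meanGap (m t : ℕ) (y : ℝ) : ℝ := if t < m then y - 1 else y

/-- The mean number of cards ahead of the marker. -/
noncomputable def meanMarker (n m : ℕ) : ℕ → ℝ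
  | 0 => m
  | t + 1 => meanGap m t (meanMarker n m t) + (meanGap m t (meanMarker n m t) + 1) / n

theorem cast_gap {n m : ℕ} (w : Fin n → Fin n) (t : ℕ) :
    (gap m t (marker m w t) : ℝ) = meanGap m t (marker m w t) := by
  have := le_marker (m := m) w t
  unfold gap meanGap
  split_ifs with h
  · rw [Nat.cast_sub (by omega)]; simp
  · rfl

open Classical in
theorem cast_marker_succ {n m : ℕ} (w : Fin n → Fin n) (t : ℕ) :
    (marker m w (t + 1) : ℝ) =
      gap m t (marker m w t) + if GoesAhead m w t then 1 else 0 := by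
  rw [marker]
  push_cast
  congr 1
  by_cases h : GoesAhead m w t
  · rw [if_pos h, if_pos (show _ ≤ _ from h)]
  · rw [if_neg h, if_neg (show ¬ (_ ≤ _) from h)]

theorem mean_meanGap {n : ℕ} (hn : 0 < n) (m t : ℕ) (f : (Fin n → Fin n) → ℝ) :
    mean n (fun w => meanGap m t (f w)) = meanGap m t (mean n f) := by
  unfold meanGap
  split_ifs
  · rw [mean_sub, mean_const hn]
  · rfl

theorem mean_marker {n m t : ℕ} (hm : m ≤ n) (ht : t ≤ n) (hn : 0 < n) :
    mean n (fun w => (marker m w t : ℝ)) = meanMarker n m t := by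
  classical
  induction t with
  | zero => simp only [marker, meanMarker, mean_const hn]
  | succ t ih =>
    simp only [cast_marker_succ]
    rw [mean_step hm (by omega) (fun g x => (g : ℝ) + x)]
    have : ∀ w : Fin n → Fin n, ((gap m t (marker m w t) : ℝ) + 1) / n *
        ((gap m t (marker m w t) : ℝ) + 1) + (1 - ((gap m t (marker m w t) : ℝ) + 1) / n) *
        ((gap m t (marker m w t) : ℝ) + 0) =
        meanGap m t (marker m w t) + (meanGap m t (marker m w t) + 1) / n := fun w => by
      rw [← cast_gap]; ring
    simp only [this]
    rw [mean_add, mean_div_const, mean_add, mean_const hn, mean_meanGap hn, ih (by omega),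
      meanMarker]

open Classical in
/-- The probability that a card is reinserted ahead of the marker. -/
theorem mean_goesAhead {n m t : ℕ} (hm : m ≤ n) (ht : t < n) :
    mean n (fun w => if GoesAhead m w t then (1 : ℝ) else 0) =
      (meanGap m t (meanMarker n m t) + 1) / n := by
  have hn : 0 < n := by omega
  rw [mean_step hm ht (fun _ x => x)]
  simp only [mul_one, mul_zero, add_zero, cast_gap]
  rw [mean_div_const, mean_add, mean_const hn, mean_meanGap hn, mean_marker hm ht.le hn]

theorem mean_sq_marker_sub_le {n m t : ℕ} (hm : m ≤ n) (ht : t ≤ n) (hn : 0 < n) :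
    mean n (fun w => ((marker m w t : ℝ) - meanMarker n m t) ^ 2) ≤
      t * (1 + 1 / (n : ℝ)) ^ (2 * t) := by
  classical
  have hn' : (0 : ℝ) < n := by positivity
  induction t with
  | zero => simp [marker, meanMarker, mean_const hn]
  | succ t ih =>
    simp only [cast_marker_succ]
    rw [mean_step hm (by omega) (fun g x => ((g : ℝ) + x - meanMarker n m (t + 1)) ^ 2)]
    have h : ∀ w : Fin n → Fin n, ((gap m t (marker m w t) : ℝ) + 1) / n *
        ((gap m t (marker m w t) : ℝ) + 1 - meanMarker n m (t + 1)) ^ 2 +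
        (1 - ((gap m t (marker m w t) : ℝ) + 1) / n) *
        ((gap m t (marker m w t) : ℝ) + 0 - meanMarker n m (t + 1)) ^ 2 ≤
        (1 + 1 / (n : ℝ)) ^ 2 * ((marker m w t : ℝ) - meanMarker n m t) ^ 2 + 1 := fun w => by
      have hd : (marker m w t : ℝ) - meanMarker n m t =
          meanGap m t (marker m w t) - meanGap m t (meanMarker n m t) := by
        unfold meanGap; split_ifs <;> ring
      rw [hd, meanMarker, cast_gap]
      generalize meanGap m t (marker m w t) = x
      generalize meanGap m t (meanMarker n m t) = y
      -- Squared bias plus variance `p (1 - p)` for a Bernoulli variable with `p = (x + 1) / n`; the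
      -- variance is bounded by `1` through `(p - 1/2)² ≥ 0`.
      have : (x + 1) / n * (x + 1 - (y + (y + 1) / n)) ^ 2 +
          (1 - (x + 1) / n) * (x + 0 - (y + (y + 1) / n)) ^ 2 =
          (1 + 1 / n) ^ 2 * (x - y) ^ 2 + (x + 1) / n * (1 - (x + 1) / n) := by
        field_simp
        ring
      rw [this]
      nlinarith [sq_nonneg ((x + 1) / n - 1 / 2)]
    refine (mean_mono h).trans ?_
    rw [mean_add, mean_const_mul, mean_const hn]
    have h1 : (1 : ℝ) ≤ 1 + 1 / (n : ℝ) := by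
      have : (0 : ℝ) ≤ 1 / n := by positivity
      linarith
    have h2 : (1 : ℝ) ≤ (1 + 1 / (n : ℝ)) ^ (2 * (t + 1)) := one_le_pow₀ h1
    have h3 : (1 + 1 / (n : ℝ)) ^ (2 * (t + 1)) =
        (1 + 1 / (n : ℝ)) ^ 2 * (1 + 1 / (n : ℝ)) ^ (2 * t) := by ring
    have h4 := mul_le_mul_of_nonneg_left (ih (by omega))
      (show (0 : ℝ) ≤ (1 + 1 / (n : ℝ)) ^ 2 by positivity)
    push_cast
    nlinarith

theorem mean_abs_marker_sub_le {n m : ℕ} (hm : m ≤ n) (hn : 0 < n) :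
    mean n (fun w => |(marker m w n : ℝ) - meanMarker n m n|) ≤
      (Real.exp 2 + 1) / 2 * Real.sqrt n := by
  have hn' : (0 : ℝ) < n := by positivity
  have hs : 0 < Real.sqrt n := Real.sqrt_pos.2 hn'
  -- The second moment is at most `n e²`, so the choice `c = √n` makes both terms of order `√n`.
  refine (mean_abs_le hn hs).trans ?_
  have h1 := mean_sq_marker_sub_le hm le_rfl hn
  have h2 : (1 + 1 / (n : ℝ)) ^ (2 * n) ≤ Real.exp 2 := by
    have : (1 + 1 / (n : ℝ)) ^ (2 * n) ≤ Real.exp (1 / n) ^ (2 * n) := by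
      gcongr
      rw [add_comm]
      exact Real.add_one_le_exp _
    refine this.trans_eq ?_
    rw [← Real.exp_nat_mul]
    congr 1
    push_cast
    field_simp
  have h3 : mean n (fun w => ((marker m w n : ℝ) - meanMarker n m n) ^ 2) ≤ n * Real.exp 2 :=
    h1.trans (by gcongr)
  have h4 : mean n (fun w => ((marker m w n : ℝ) - meanMarker n m n) ^ 2) / Real.sqrt n ≤
      Real.sqrt n * Real.exp 2 := by
    rw [div_le_iff₀ hs]
    refine h3.trans_eq ?_
    rw [mul_right_comm, Real.mul_self_sqrt hn'.le]
  linarith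

/-- The mean position of the marker in closed form. -/
theorem meanMarker_eq {n : ℕ} (hn : 0 < n) (m t : ℕ) :
    meanMarker n m t + 1 =
      (n + 1 - (n - m) * (1 + 1 / (n : ℝ)) ^ min t m) * (1 + 1 / (n : ℝ)) ^ (t - m) := by
  have hn' : (n : ℝ) ≠ 0 := by positivity
  induction t with
  | zero => simp [meanMarker, add_comm]
  | succ t ih =>
    rw [meanMarker, meanGap]
    -- Before time `m` the distance of the mean from `n` is multiplied by `1 + 1/n` in each step;
    -- from time `m` on, the mean plus one is.
    split_ifs with h
    · have h1 : min (t + 1) m = t + 1 := by omega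
      have h2 : min t m = t := by omega
      have h3 : t + 1 - m = 0 := by omega
      have h4 : t - m = 0 := by omega
      rw [h2, h4, pow_zero, mul_one] at ih
      rw [h1, h3, pow_zero, mul_one, pow_succ, eq_sub_of_add_eq ih]
      field_simp
      ring
    · have h1 : min (t + 1) m = m := by omega
      have h2 : min t m = m := by omega
      have h3 : t + 1 - m = (t - m) + 1 := by omega
      rw [h2] at ih
      rw [h1, h3, pow_succ, ← mul_assoc, ← ih]
      field_simp
      ring

/-! ### The function `xOf` and its inverse -/

theorem xOf_zero : xOf 0 = 0 := by simp [xOf]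

theorem xOf_one : xOf 1 = 1 := by simp [xOf]

theorem hasDerivAt_xOf (b : ℝ) : HasDerivAt xOf (Real.exp 1 - Real.exp (1 - b)) b := by
  have h : HasDerivAt (fun b : ℝ => 1 - b) (-1) b := by
    simpa using (hasDerivAt_id b).const_sub 1
  have := h.exp.sub (h.mul_const (Real.exp 1))
  convert! this using 1
  ring

theorem continuous_xOf : Continuous xOf := by
  unfold xOf
  fun_prop

theorem strictMonoOn_xOf : StrictMonoOn xOf (Ici 0) := by
  refine strictMonoOn_of_deriv_pos (convex_Ici 0) continuous_xOf.continuousOn fun b hb => ?_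
  rw [interior_Ici] at hb
  rw [(hasDerivAt_xOf b).deriv, sub_pos, Real.exp_lt_exp]
  linarith [mem_Ioi.1 hb]

/-- Inverting on the whole half-line, not only on `[0, 1)`, gives an inverse that takes the value
`1` at `1` and is differentiable there from both sides. -/
theorem surjOn_xOf : SurjOn xOf (Ici 0) (Ici 0) := by
  intro x hx
  have hx : 0 ≤ x := hx
  -- `xOf (x + 1) = e^(-x) + x e`.
  have h1 : x ≤ xOf (x + 1) := by
    have h2 : 1 ≤ Real.exp 1 := Real.one_le_exp zero_le_one
    have h3 := Real.exp_pos (1 - (x + 1))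
    unfold xOf
    nlinarith
  obtain ⟨b, hb, hbx⟩ := intermediate_value_Icc (show (0 : ℝ) ≤ x + 1 by linarith)
    continuous_xOf.continuousOn (show x ∈ Icc (xOf 0) (xOf (x + 1)) by
      rw [xOf_zero]; exact ⟨hx, h1⟩)
  exact ⟨b, hb.1, hbx⟩

/-- The inverse of `xOf` on `[0, ∞)`. -/
noncomputable def xInv (x : ℝ) : ℝ := Function.invFunOn xOf (Ici 0) x

theorem xInv_nonneg {x : ℝ} (hx : 0 ≤ x) : 0 ≤ xInv x :=
  Function.invFunOn_mem (surjOn_xOf hx)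

theorem xOf_xInv {x : ℝ} (hx : 0 ≤ x) : xOf (xInv x) = x :=
  Function.invFunOn_eq (surjOn_xOf hx)

theorem xOf_nonneg {b : ℝ} (hb : 0 ≤ b) : 0 ≤ xOf b :=
  xOf_zero ▸ strictMonoOn_xOf.monotoneOn self_mem_Ici hb hb

theorem xInv_xOf {b : ℝ} (hb : 0 ≤ b) : xInv (xOf b) = b :=
  strictMonoOn_xOf.injOn (xInv_nonneg (xOf_nonneg hb)) hb (xOf_xInv (xOf_nonneg hb))

theorem xInv_zero : xInv 0 = 0 := by
  simpa [xOf_zero] using xInv_xOf le_rfl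

theorem xInv_one : xInv 1 = 1 := by
  simpa [xOf_one] using xInv_xOf zero_le_one

theorem xInv_lt_iff {x b : ℝ} (hx : 0 ≤ x) (hb : 0 ≤ b) : xInv x < b ↔ x < xOf b := by
  rw [← strictMonoOn_xOf.lt_iff_lt (xInv_nonneg hx) hb, xOf_xInv hx]

theorem lt_xInv_iff {x b : ℝ} (hx : 0 ≤ x) (hb : 0 ≤ b) : b < xInv x ↔ xOf b < x := by
  rw [← strictMonoOn_xOf.lt_iff_lt hb (xInv_nonneg hx), xOf_xInv hx]

theorem xInv_le_iff {x b : ℝ} (hx : 0 ≤ x) (hb : 0 ≤ b) : xInv x ≤ b ↔ x ≤ xOf b := by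
  rw [← not_lt, lt_xInv_iff hx hb, not_lt]

theorem le_xInv_iff {x b : ℝ} (hx : 0 ≤ x) (hb : 0 ≤ b) : b ≤ xInv x ↔ xOf b ≤ x := by
  rw [← not_lt, xInv_lt_iff hx hb, not_lt]

theorem xInv_pos {x : ℝ} (hx : 0 < x) : 0 < xInv x := by
  rwa [lt_xInv_iff hx.le le_rfl, xOf_zero]

theorem xInv_lt_one {x : ℝ} (hx : 0 ≤ x) (hx1 : x < 1) : xInv x < 1 := by
  rwa [xInv_lt_iff hx zero_le_one, xOf_one]

theorem xInv_le_one {x : ℝ} (hx : 0 ≤ x) (hx1 : x ≤ 1) : xInv x ≤ 1 := by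
  rwa [xInv_le_iff hx zero_le_one, xOf_one]

theorem strictMonoOn_xInv : StrictMonoOn xInv (Ici 0) := fun x hx y hy h => by
  rwa [xInv_lt_iff hx (xInv_nonneg hy), xOf_xInv hy]

theorem continuousAt_xInv {x : ℝ} (hx : 0 < x) : ContinuousAt xInv x := by
  refine strictMonoOn_xInv.continuousAt_of_image_mem_nhds (Ici_mem_nhds hx) ?_
  refine mem_of_superset (Ici_mem_nhds (xInv_pos hx)) fun b hb => ?_
  exact ⟨xOf b, xOf_nonneg hb, xInv_xOf hb⟩

theorem continuousOn_xInv : ContinuousOn xInv (Ici 0) := by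
  intro x hx
  rcases eq_or_lt_of_le (show 0 ≤ x from hx) with rfl | h
  · refine strictMonoOn_xInv.continuousWithinAt_right_of_surjOn self_mem_nhdsWithin fun b hb => ?_
    rw [xInv_zero] at hb
    exact ⟨xOf b, xOf_nonneg (le_of_lt hb), xInv_xOf (le_of_lt hb)⟩
  · exact (continuousAt_xInv h).continuousWithinAt

theorem deriv_xOf_pos {b : ℝ} (hb : 0 < b) : 0 < Real.exp 1 - Real.exp (1 - b) := by
  rw [sub_pos, Real.exp_lt_exp]
  linarith

theorem hasDerivAt_xInv {x : ℝ} (hx : 0 < x) :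
    HasDerivAt xInv (Real.exp 1 - Real.exp (1 - xInv x))⁻¹ x := by
  refine HasDerivAt.of_local_left_inverse (continuousAt_xInv hx) (hasDerivAt_xOf (xInv x))
    (deriv_xOf_pos (xInv_pos hx)).ne' ?_
  filter_upwards [Ioi_mem_nhds hx] with y hy using xOf_xInv (le_of_lt hy)

theorem bijOn_xOf : BijOn xOf (Ico 0 1) (Ico 0 1) := by
  refine ⟨fun b hb => ⟨xOf_nonneg hb.1, ?_⟩, fun b hb c hc h => ?_, fun x hx => ?_⟩
  · have := strictMonoOn_xOf hb.1 (show (0 : ℝ) ≤ 1 from zero_le_one) hb.2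
    rwa [xOf_one] at this
  · exact strictMonoOn_xOf.injOn hb.1 hc.1 h
  · exact ⟨xInv x, ⟨xInv_nonneg hx.1, xInv_lt_one hx.1 hx.2⟩, xOf_xInv hx.1⟩

theorem bOf_eq_xInv {x : ℝ} (hx : x ∈ Ico (0 : ℝ) 1) : bOf x = xInv x := by
  have h1 : bOf x ∈ Ico (0 : ℝ) 1 := Function.invFunOn_mem (bijOn_xOf.surjOn hx)
  have h2 : xOf (bOf x) = x := Function.invFunOn_eq (bijOn_xOf.surjOn hx)
  rw [← xInv_xOf h1.1, h2]

/-! ### The fluid limit of the marker -/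

/-- The rescaled number of cards ahead of the marker at time `b * n` if it is laid behind card
`β * n`. -/
noncomputable def flow (b β : ℝ) : ℝ :=
  (1 - (1 - β) * Real.exp (min b β)) * Real.exp (max (b - β) 0)

theorem continuous_flow (b : ℝ) : Continuous (flow b) := by
  unfold flow
  fun_prop

theorem flow_one_left {β : ℝ} (hβ : β ≤ 1) : flow 1 β = xOf β := by
  have h : Real.exp 1 = Real.exp β * Real.exp (1 - β) := by rw [← Real.exp_add]; ring_nf
  rw [flow, min_eq_right hβ, max_eq_left (by linarith), xOf, h]
  ring

theorem flow_one_right {b : ℝ} (hb : b ≤ 1) : flow b 1 = 1 := by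
  simp [flow, max_eq_right (show b - 1 ≤ 0 by linarith)]

theorem flow_zero_right {b : ℝ} (hb : 0 ≤ b) : flow b 0 = 0 := by
  simp [flow, min_eq_right hb]

/-- Once all cards laid ahead of the marker have been moved, it grows exponentially at rate one, so
its place at time `b` is its final place `xOf β` discounted by `e^(b - 1)`. -/
theorem flow_of_le {b β : ℝ} (h : β ≤ b) : flow b β = xOf β * Real.exp (b - 1) := by
  have h1 : Real.exp (1 - β) * Real.exp (b - 1) = Real.exp (b - β) := by
    rw [← Real.exp_add]; ring_nf
  have h2 : Real.exp 1 * Real.exp (b - 1) = Real.exp β * Real.exp (b - β) := by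
    rw [← Real.exp_add, ← Real.exp_add]; ring_nf
  rw [flow, min_eq_right h, max_eq_left (by linarith), xOf]
  linear_combination (-1 : ℝ) * h1 + (1 - β) * h2

theorem flow_of_ge {b β : ℝ} (h : b ≤ β) : flow b β = 1 - (1 - β) * Real.exp b := by
  rw [flow, min_eq_left h, max_eq_right (by linarith)]
  simp

/-- The power is `((1 + 1/n)^n)^(t/n)`, with base tending to `e` and exponent to `τ`. -/
theorem tendsto_one_add_inv_pow {t : ℕ → ℕ} {τ : ℝ}
    (ht : Tendsto (fun n : ℕ => (t n : ℝ) / n) atTop (𝓝 τ)) :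
    Tendsto (fun n : ℕ => (1 + 1 / (n : ℝ)) ^ t n) atTop (𝓝 (Real.exp τ)) := by
  have h := (Real.tendsto_one_add_div_pow_exp 1).rpow ht (Or.inl (Real.exp_pos 1).ne')
  rw [← Real.exp_mul, one_mul] at h
  refine h.congr' ?_
  filter_upwards [eventually_gt_atTop 0] with n hn
  have hn' : (n : ℝ) ≠ 0 := by positivity
  rw [← Real.rpow_natCast, ← Real.rpow_mul (by positivity), mul_div_cancel₀ _ hn',
    Real.rpow_natCast]

theorem tendsto_meanMarker {m t : ℕ → ℕ} {β b : ℝ}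
    (hm : Tendsto (fun n : ℕ => (m n : ℝ) / n) atTop (𝓝 β))
    (ht : Tendsto (fun n : ℕ => (t n : ℝ) / n) atTop (𝓝 b)) :
    Tendsto (fun n : ℕ => meanMarker n (m n) (t n) / n) atTop (𝓝 (flow b β)) := by
  have h1 : Tendsto (fun n : ℕ => (min (t n) (m n) : ℕ) / (n : ℝ)) atTop (𝓝 (min b β)) := by
    refine (ht.min hm).congr fun n => ?_
    rw [Nat.cast_min, min_div_div_right (Nat.cast_nonneg n)]
  have h2 : Tendsto (fun n : ℕ => (t n - m n : ℕ) / (n : ℝ)) atTop (𝓝 (max (b - β) 0)) := by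
    refine ((ht.sub hm).max tendsto_const_nhds).congr fun n => ?_
    rcases le_total (m n) (t n) with h | h
    · rw [Nat.cast_sub h, ← sub_div, max_eq_left]
      have : (m n : ℝ) ≤ t n := by exact_mod_cast h
      exact div_nonneg (by linarith) (Nat.cast_nonneg n)
    · rw [Nat.sub_eq_zero_of_le h, ← sub_div, max_eq_right]
      · simp
      · have : (t n : ℝ) ≤ m n := by exact_mod_cast h
        exact div_nonpos_of_nonpos_of_nonneg (by linarith) (Nat.cast_nonneg n)
  have h3 : Tendsto (fun n : ℕ => 1 / (n : ℝ)) atTop (𝓝 0) := tendsto_one_div_atTop_nhds_zero_nat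
  have h4 := (((h3.const_add 1).sub ((hm.const_sub 1).mul (tendsto_one_add_inv_pow h1))).mul
    (tendsto_one_add_inv_pow h2)).sub h3
  rw [add_zero, sub_zero] at h4
  refine h4.congr' ?_
  filter_upwards [eventually_gt_atTop 0] with n hn
  have hn' : (n : ℝ) ≠ 0 := by positivity
  rw [eq_sub_of_add_eq (meanMarker_eq hn (m n) (t n))]
  field_simp

theorem tendsto_mean_goesAhead {m t : ℕ → ℕ} {β b : ℝ}
    (hm : Tendsto (fun n : ℕ => (m n : ℝ) / n) atTop (𝓝 β))
    (ht : Tendsto (fun n : ℕ => (t n : ℝ) / n) atTop (𝓝 b)) :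
    Tendsto (fun n : ℕ => (meanGap (m n) (t n) (meanMarker n (m n) (t n)) + 1) / n) atTop
      (𝓝 (flow b β)) := by
  have h1 := tendsto_meanMarker hm ht
  have h3 : Tendsto (fun n : ℕ => 1 / (n : ℝ)) atTop (𝓝 0) := tendsto_one_div_atTop_nhds_zero_nat
  have h2 := h1.add h3
  rw [add_zero] at h2
  refine tendsto_of_tendsto_of_tendsto_of_le_of_le h1 h2 (fun n => ?_) (fun n => ?_)
  · refine div_le_div_of_nonneg_right ?_ (Nat.cast_nonneg n)
    unfold meanGap
    split_ifs <;> linarith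
  · simp only [← add_div]
    refine div_le_div_of_nonneg_right ?_ (Nat.cast_nonneg n)
    unfold meanGap
    split_ifs <;> linarith

theorem tendsto_self_div : Tendsto (fun n : ℕ => (n : ℝ) / n) atTop (𝓝 1) := by
  refine tendsto_const_nhds.congr' ?_
  filter_upwards [eventually_gt_atTop 0] with n hn
  have hn' : (n : ℝ) ≠ 0 := by positivity
  rw [div_self hn']

/-- The law of large numbers for the final position of the marker. -/
theorem tendsto_mean_abs_marker_sub {m : ℕ → ℕ} {β : ℝ} (hmn : ∀ n, m n ≤ n) (hβ : β ≤ 1)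
    (hm : Tendsto (fun n : ℕ => (m n : ℝ) / n) atTop (𝓝 β)) :
    Tendsto (fun n : ℕ => mean n (fun w => |(marker (m n) w n : ℝ) / n - xOf β|)) atTop
      (𝓝 0) := by
  have h1 := tendsto_meanMarker hm tendsto_self_div
  rw [flow_one_left hβ] at h1
  have h2 : Tendsto (fun n : ℕ => |meanMarker n (m n) n / n - xOf β|) atTop (𝓝 0) := by
    simpa using (h1.sub_const (xOf β)).abs
  have h3 : Tendsto (fun n : ℕ => (Real.exp 2 + 1) / 2 * (Real.sqrt n)⁻¹) atTop (𝓝 0) := by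
    have := (tendsto_inv_atTop_zero.comp
      (Real.tendsto_sqrt_atTop.comp tendsto_natCast_atTop_atTop)).const_mul ((Real.exp 2 + 1) / 2)
    simpa using this
  have h4 := h3.add h2
  rw [add_zero] at h4
  refine tendsto_of_tendsto_of_tendsto_of_le_of_le' tendsto_const_nhds h4
    (Eventually.of_forall fun n => mean_nonneg fun w => abs_nonneg _) ?_
  filter_upwards [eventually_gt_atTop 0] with n hn
  have hn' : (0 : ℝ) < n := by positivity
  have h5 := div_le_div_of_nonneg_right (mean_abs_marker_sub_le (hmn n) hn) hn'.le
  calc mean n (fun w => |(marker (m n) w n : ℝ) / n - xOf β|)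
      ≤ mean n (fun w => |(marker (m n) w n : ℝ) - meanMarker n (m n) n| / n +
          |meanMarker n (m n) n / n - xOf β|) := mean_mono fun w => by
        rw [← abs_of_pos hn', ← abs_div, abs_of_pos hn']
        refine (abs_add_le _ _).trans_eq' ?_
        congr 1
        ring
    _ = mean n (fun w => |(marker (m n) w n : ℝ) - meanMarker n (m n) n|) / n +
          |meanMarker n (m n) n / n - xOf β| := by
        rw [mean_add, mean_const hn, mean_div_const]
    _ ≤ _ := by
        gcongr
        refine h5.trans_eq ?_
        rw [mul_div_assoc, Real.sqrt_div_self']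
        simp

/-! ### The limiting distribution of the position of a card -/

theorem floor_mul_le {β : ℝ} (hβ : β ≤ 1) (n : ℕ) : ⌊β * n⌋₊ ≤ n := by
  refine Nat.floor_le_of_le ?_
  have : (0 : ℝ) ≤ n := Nat.cast_nonneg n
  nlinarith

theorem tendsto_floor_mul_div {β : ℝ} (hβ : 0 ≤ β) :
    Tendsto (fun n : ℕ => (⌊β * n⌋₊ : ℝ) / n) atTop (𝓝 β) :=
  (tendsto_nat_floor_mul_div_atTop hβ).comp tendsto_natCast_atTop_atTop

open Classical in
theorem tendsto_mean_position_le_marker {m j : ℕ → ℕ} {β b : ℝ} (hmn : ∀ n, m n ≤ n)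
    (hm : Tendsto (fun n : ℕ => (m n : ℝ) / n) atTop (𝓝 β))
    (hjn : ∀ᶠ n in atTop, 1 ≤ j n ∧ j n ≤ n)
    (hj : Tendsto (fun n : ℕ => (j n : ℝ) / n) atTop (𝓝 b)) :
    Tendsto (fun n : ℕ => mean n (fun w =>
      if position (finalDeck n w) (j n) ≤ marker (m n) w n then (1 : ℝ) else 0)) atTop
      (𝓝 (flow b β)) := by
  have ht : Tendsto (fun n : ℕ => ((j n - 1 : ℕ) : ℝ) / n) atTop (𝓝 b) := by
    have h := hj.sub tendsto_one_div_atTop_nhds_zero_nat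
    rw [sub_zero] at h
    refine h.congr' ?_
    filter_upwards [hjn] with n hn
    rw [Nat.cast_sub hn.1, ← sub_div, Nat.cast_one]
  refine (tendsto_mean_goesAhead hm ht).congr' ?_
  filter_upwards [hjn] with n hn
  rw [← mean_goesAhead (hmn n) (show j n - 1 < n by omega)]
  simp only [position_le_marker_iff (hmn n) _ hn.1 hn.2]

theorem positionProb_le_one {n : ℕ} (hn : 0 < n) (j : ℕ) (x : ℝ) : positionProb n j x ≤ 1 := by
  classical
  rw [positionProb, shuffleProb_eq_mean]
  refine (mean_mono (g := fun _ => 1) fun w => ?_).trans_eq (mean_const hn 1)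
  split_ifs <;> norm_num

theorem positionProb_nonneg (n j : ℕ) (x : ℝ) : 0 ≤ positionProb n j x := by
  classical
  rw [positionProb, shuffleProb_eq_mean]
  exact mean_nonneg fun w => by split_ifs <;> norm_num

section limit

variable {j : ℕ → ℕ} {b β x : ℝ}

/-- A card in a position at most `xn` is ahead of the marker unless the marker finishes before `xn`.
The latter has vanishing probability, by Markov's inequality, as the marker finishes near `xOf β *
n`. -/
theorem eventually_positionProb_lt (hβ0 : 0 ≤ β) (hβ1 : β ≤ 1) (hx : x < xOf β)
    (hjn : ∀ᶠ n in atTop, 1 ≤ j n ∧ j n ≤ n)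
    (hj : Tendsto (fun n : ℕ => (j n : ℝ) / n) atTop (𝓝 b)) {c : ℝ} (hc : flow b β < c) :
    ∀ᶠ n in atTop, positionProb n (j n) x < c := by
  classical
  have hm := tendsto_floor_mul_div hβ0
  have h1 := tendsto_mean_position_le_marker (floor_mul_le hβ1) hm hjn hj
  have h2 := (tendsto_mean_abs_marker_sub (floor_mul_le hβ1) hβ1 hm).div_const (xOf β - x)
  have h3 := h1.add h2
  rw [zero_div, add_zero] at h3
  filter_upwards [h3.eventually (gt_mem_nhds hc), eventually_gt_atTop 0] with n hn hn0
  refine lt_of_le_of_lt ?_ hn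
  have hn' : (0 : ℝ) < n := by positivity
  have h4 := mean_indicator_le (n := n) (f := fun w => |(marker ⌊β * n⌋₊ w n : ℝ) / n - xOf β|)
    (A := fun w => (marker ⌊β * n⌋₊ w n : ℝ) < x * n) (fun w => abs_nonneg _)
    (sub_pos.2 hx) (fun w hw => by
      rw [← div_lt_iff₀ hn'] at hw
      rw [abs_sub_comm]
      exact le_trans (by linarith) (le_abs_self _))
  refine le_trans ?_ (add_le_add_right h4 _)
  rw [positionProb, shuffleProb_eq_mean, ← mean_add]
  refine mean_mono fun w => ?_
  by_cases ha : (position (finalDeck n w) (j n) : ℝ) ≤ x * n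
  · by_cases hb : position (finalDeck n w) (j n) ≤ marker ⌊β * n⌋₊ w n
    · rw [if_pos ha, if_pos hb]; split_ifs <;> norm_num
    · have hb' : (marker ⌊β * n⌋₊ w n : ℝ) < position (finalDeck n w) (j n) := by
        exact_mod_cast not_le.1 hb
      rw [if_pos ha, if_neg hb, if_pos (hb'.trans_le ha)]; norm_num
  · rw [if_neg ha]; split_ifs <;> norm_num

theorem eventually_lt_positionProb (hβ0 : 0 ≤ β) (hβ1 : β ≤ 1) (hx : xOf β < x)
    (hjn : ∀ᶠ n in atTop, 1 ≤ j n ∧ j n ≤ n)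
    (hj : Tendsto (fun n : ℕ => (j n : ℝ) / n) atTop (𝓝 b)) {c : ℝ} (hc : c < flow b β) :
    ∀ᶠ n in atTop, c < positionProb n (j n) x := by
  classical
  have hm := tendsto_floor_mul_div hβ0
  have h1 := tendsto_mean_position_le_marker (floor_mul_le hβ1) hm hjn hj
  have h2 := (tendsto_mean_abs_marker_sub (floor_mul_le hβ1) hβ1 hm).div_const (x - xOf β)
  have h3 := h1.sub h2
  rw [zero_div, sub_zero] at h3
  filter_upwards [h3.eventually (lt_mem_nhds hc), eventually_gt_atTop 0] with n hn hn0
  refine lt_of_lt_of_le hn ?_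
  have hn' : (0 : ℝ) < n := by positivity
  have h4 := mean_indicator_le (n := n) (f := fun w => |(marker ⌊β * n⌋₊ w n : ℝ) / n - xOf β|)
    (A := fun w => x * n < (marker ⌊β * n⌋₊ w n : ℝ)) (fun w => abs_nonneg _)
    (sub_pos.2 hx) (fun w hw => by
      rw [← lt_div_iff₀ hn'] at hw
      exact le_trans (by linarith) (le_abs_self _))
  refine le_trans (sub_le_sub_left h4 _) ?_
  rw [positionProb, shuffleProb_eq_mean, ← mean_sub]
  refine mean_mono fun w => ?_
  by_cases ha : (position (finalDeck n w) (j n) : ℝ) ≤ x * n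
  · rw [if_pos ha]; split_ifs <;> norm_num
  · by_cases hb : position (finalDeck n w) (j n) ≤ marker ⌊β * n⌋₊ w n
    · have hb' : (position (finalDeck n w) (j n) : ℝ) ≤ marker ⌊β * n⌋₊ w n := by
        exact_mod_cast hb
      rw [if_neg ha, if_pos hb, if_pos ((not_le.1 ha).trans_le hb')]; norm_num
    · rw [if_neg ha, if_neg hb]; split_ifs <;> norm_num

theorem tendsto_positionProb (hb : b ∈ Icc (0 : ℝ) 1) (hx : x ∈ Icc (0 : ℝ) 1)
    (hjn : ∀ᶠ n in atTop, 1 ≤ j n ∧ j n ≤ n)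
    (hj : Tendsto (fun n : ℕ => (j n : ℝ) / n) atTop (𝓝 b)) :
    Tendsto (fun n : ℕ => positionProb n (j n) x) atTop (𝓝 (flow b (xInv x))) := by
  have h0 := xInv_nonneg hx.1
  have h1 := xInv_le_one hx.1 hx.2
  have hcont := (continuous_flow b).continuousAt (x := xInv x)
  refine tendsto_order.2 ⟨fun c hc => ?_, fun c hc => ?_⟩
  -- If `xInv x = 0` there is no room for a marker on the left, but the limit is then `0` and the
  -- lower bound is trivial; likewise on the right if `xInv x = 1`.
  · rcases eq_or_lt_of_le h0 with h | h
    · rw [← h, flow_zero_right hb.1] at hc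
      exact Eventually.of_forall fun n => hc.trans_le (positionProb_nonneg _ _ _)
    · have hev : ∀ᶠ β in 𝓝[<] xInv x, c < flow b β :=
        nhdsWithin_le_nhds (hcont.eventually (lt_mem_nhds hc))
      obtain ⟨β, hβ, hβ'⟩ := (hev.and (Ioo_mem_nhdsLT h)).exists
      exact eventually_lt_positionProb hβ'.1.le (hβ'.2.le.trans h1)
        ((lt_xInv_iff hx.1 hβ'.1.le).1 hβ'.2) hjn hj hβ
  · rcases eq_or_lt_of_le h1 with h | h
    · rw [h, flow_one_right hb.2] at hc
      filter_upwards [eventually_gt_atTop 0] with n hn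
      exact (positionProb_le_one hn _ _).trans_lt hc
    · have hev : ∀ᶠ β in 𝓝[>] xInv x, flow b β < c :=
        nhdsWithin_le_nhds (hcont.eventually (gt_mem_nhds hc))
      obtain ⟨β, hβ, hβ'⟩ := (hev.and (Ioo_mem_nhdsGT h)).exists
      have hβ0 : 0 ≤ β := h0.trans hβ'.1.le
      exact eventually_positionProb_lt hβ0 hβ'.2.le
        ((xInv_lt_iff hx.1 hβ0).1 hβ'.1) hjn hj hβ

end limit

theorem positionCDF_eq {b x : ℝ} (hb : b ∈ Icc (0 : ℝ) 1) (hx : x ∈ Icc (0 : ℝ) 1) :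
    positionCDF b x = flow b (xInv x) := by
  -- The sequence `max 1 ⌈b * n⌉₊` in the definition is admissible, so `limUnder` is an actual
  -- limit.
  refine Tendsto.limUnder_eq (tendsto_positionProb hb hx ?_ ?_)
  · filter_upwards [eventually_ge_atTop 1] with n hn
    refine ⟨le_max_left _ _, max_le hn (Nat.ceil_le.2 ?_)⟩
    have : (0 : ℝ) ≤ n := Nat.cast_nonneg n
    nlinarith [hb.2]
  · have h1 : Tendsto (fun n : ℕ => (⌈b * n⌉₊ : ℝ) / n) atTop (𝓝 b) :=
      (tendsto_nat_ceil_mul_div_atTop hb.1).comp tendsto_natCast_atTop_atTop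
    have h2 := (tendsto_one_div_atTop_nhds_zero_nat (𝕜 := ℝ)).max h1
    rw [max_eq_right hb.1] at h2
    refine h2.congr fun n => ?_
    rw [Nat.cast_max, Nat.cast_one, max_div_div_right (Nat.cast_nonneg n)]

/-! ### The density of the position of a card -/

theorem positionCDF_of_le {b x : ℝ} (hb : b ∈ Icc (0 : ℝ) 1) (hx : x ∈ Icc (0 : ℝ) 1)
    (h : x ≤ xOf b) : positionCDF b x = x * Real.exp (b - 1) := by
  rw [positionCDF_eq hb hx, flow_of_le ((xInv_le_iff hx.1 hb.1).2 h), xOf_xInv hx.1]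

theorem positionCDF_of_ge {b x : ℝ} (hb : b ∈ Icc (0 : ℝ) 1) (hx : x ∈ Icc (0 : ℝ) 1)
    (h : xOf b ≤ x) : positionCDF b x = 1 - (1 - xInv x) * Real.exp b := by
  rw [positionCDF_eq hb hx, flow_of_ge ((le_xInv_iff hx.1 hb.1).2 h)]

theorem hasDerivWithinAt_positionCDF_of_lt {b x : ℝ} (hb : b ∈ Icc (0 : ℝ) 1)
    (hx : x ∈ Icc (0 : ℝ) 1) (h : x < xOf b) :
    HasDerivWithinAt (positionCDF b) (Real.exp (b - 1)) (Icc 0 1) x := by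
  have h1 : HasDerivWithinAt (fun y : ℝ => y * Real.exp (b - 1)) (Real.exp (b - 1)) (Icc 0 1) x := by
    simpa using ((hasDerivAt_id x).mul_const (Real.exp (b - 1))).hasDerivWithinAt
  refine h1.congr_of_eventuallyEq ?_ (positionCDF_of_le hb hx h.le)
  filter_upwards [self_mem_nhdsWithin, mem_nhdsWithin_of_mem_nhds (Iio_mem_nhds h)] with y hy hy'
  exact positionCDF_of_le hb hy (le_of_lt hy')

theorem hasDerivWithinAt_positionCDF_of_gt {b x : ℝ} (hb : b ∈ Icc (0 : ℝ) 1)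
    (hx : x ∈ Icc (0 : ℝ) 1) (h : xOf b < x) :
    HasDerivWithinAt (positionCDF b) (Real.exp b * (Real.exp 1 - Real.exp (1 - xInv x))⁻¹)
      (Icc 0 1) x := by
  have h0 : 0 < x := (xOf_nonneg hb.1).trans_lt h
  have h1 : HasDerivWithinAt (fun y : ℝ => 1 - (1 - xInv y) * Real.exp b)
      (Real.exp b * (Real.exp 1 - Real.exp (1 - xInv x))⁻¹) (Icc 0 1) x := by
    convert! ((((hasDerivAt_xInv h0).const_sub 1).mul_const (Real.exp b)).const_sub
      1).hasDerivWithinAt using 1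
    ring
  refine h1.congr_of_eventuallyEq ?_ (positionCDF_of_ge hb hx h.le)
  filter_upwards [self_mem_nhdsWithin, mem_nhdsWithin_of_mem_nhds (Ioi_mem_nhds h)] with y hy hy'
  exact positionCDF_of_ge hb hy (le_of_lt hy')

theorem differentiableWithinAt_positionCDF {b x : ℝ} (hb : b ∈ Icc (0 : ℝ) 1)
    (hx : x ∈ Icc (0 : ℝ) 1) (h : x ≠ xOf b) :
    DifferentiableWithinAt ℝ (positionCDF b) (Icc 0 1) x := by
  rcases lt_or_gt_of_ne h with h | h
  · exact (hasDerivWithinAt_positionCDF_of_lt hb hx h).differentiableWithinAt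
  · exact (hasDerivWithinAt_positionCDF_of_gt hb hx h).differentiableWithinAt

theorem cardDensity_of_gt {b x : ℝ} (hb : b ∈ Icc (0 : ℝ) 1) (hx : x ∈ Icc (0 : ℝ) 1)
    (h : xInv x < b) : cardDensity x b = Real.exp (b - 1) :=
  (hasDerivWithinAt_positionCDF_of_lt hb hx ((xInv_lt_iff hx.1 hb.1).1 h)).derivWithin
    (uniqueDiffOn_Icc zero_lt_one x hx)

theorem cardDensity_of_lt {b x : ℝ} (hb : b ∈ Icc (0 : ℝ) 1) (hx : x ∈ Icc (0 : ℝ) 1)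
    (h : b < xInv x) :
    cardDensity x b = Real.exp b * (Real.exp 1 - Real.exp (1 - xInv x))⁻¹ :=
  (hasDerivWithinAt_positionCDF_of_gt hb hx ((lt_xInv_iff hx.1 hb.1).1 h)).derivWithin
    (uniqueDiffOn_Icc zero_lt_one x hx)

theorem cardDensity_nonneg {b x : ℝ} (hb : b ∈ Icc (0 : ℝ) 1) (hx : x ∈ Icc (0 : ℝ) 1)
    (h : b ≠ xInv x) : 0 ≤ cardDensity x b := by
  rcases lt_or_gt_of_ne h with h | h
  · rw [cardDensity_of_lt hb hx h]
    have := deriv_xOf_pos (hb.1.trans_lt h)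
    positivity
  · rw [cardDensity_of_gt hb hx h]
    positivity

/-- The fundamental theorem of calculus for a function with nonnegative derivative off one point. -/
theorem integrableOn_and_integral_eq_of_hasDerivAt_of_ne {f f' : ℝ → ℝ} {p : ℝ}
    (hp : p ∈ Icc (0 : ℝ) 1) (hf : ContinuousOn f (Icc 0 1))
    (hf' : ∀ x ∈ Ioo (0 : ℝ) 1, x ≠ p → HasDerivAt f (f' x) x)
    (h0 : ∀ x ∈ Ioo (0 : ℝ) 1, x ≠ p → 0 ≤ f' x) :
    IntegrableOn f' (Icc 0 1) ∧ ∀ x ∈ Icc (0 : ℝ) 1, ∫ t in (0 : ℝ)..x, f' t = f x - f 0 := by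
  have hint : IntegrableOn f' (Icc 0 1) := by
    rw [integrableOn_Icc_iff_integrableOn_Ioc, ← Ioc_union_Ioc_eq_Ioc hp.1 hp.2]
    refine IntegrableOn.union ?_ ?_
    · refine intervalIntegral.integrableOn_deriv_of_nonneg (hf.mono (Icc_subset_Icc_right hp.2))
        (fun x hx => hf' x ⟨hx.1, hx.2.trans_le hp.2⟩ hx.2.ne)
        (fun x hx => h0 x ⟨hx.1, hx.2.trans_le hp.2⟩ hx.2.ne)
    · refine intervalIntegral.integrableOn_deriv_of_nonneg (hf.mono (Icc_subset_Icc_left hp.1))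
        (fun x hx => hf' x ⟨hp.1.trans_lt hx.1, hx.2⟩ hx.1.ne')
        (fun x hx => h0 x ⟨hp.1.trans_lt hx.1, hx.2⟩ hx.1.ne')
  refine ⟨hint, fun x hx => ?_⟩
  refine integral_eq_of_hasDerivAt_off_countable_of_le f f' hx.1 (countable_singleton p)
    (hf.mono (Icc_subset_Icc_right hx.2))
    (fun y hy => hf' y ⟨hy.1.1, hy.1.2.trans_le hx.2⟩ hy.2) ?_
  rw [intervalIntegrable_iff_integrableOn_Icc_of_le hx.1]
  exact hint.mono_set (Icc_subset_Icc_right hx.2)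

theorem integral_positionDensity {b : ℝ} (hb : b ∈ Icc (0 : ℝ) 1) :
    IntegrableOn (positionDensity b) (Icc 0 1) ∧
      ∀ x ∈ Icc (0 : ℝ) 1, ∫ t in (0 : ℝ)..x, positionDensity b t = positionCDF b x := by
  have hcont : ContinuousOn (positionCDF b) (Icc 0 1) := by
    refine ContinuousOn.congr ?_ (fun x hx => positionCDF_eq hb hx)
    exact (continuous_flow b).comp_continuousOn (continuousOn_xInv.mono fun x hx => hx.1)
  have hp : xOf b ∈ Icc (0 : ℝ) 1 := by
    refine ⟨xOf_nonneg hb.1, ?_⟩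
    rw [← xOf_one]
    exact strictMonoOn_xOf.monotoneOn hb.1 (show (0 : ℝ) ≤ 1 from zero_le_one) hb.2
  have h := integrableOn_and_integral_eq_of_hasDerivAt_of_ne (f := positionCDF b)
    (f' := positionDensity b) hp hcont
    (fun x hx hne => (differentiableWithinAt_positionCDF hb (Ioo_subset_Icc_self hx)
      hne).hasDerivWithinAt.hasDerivAt (Icc_mem_nhds hx.1 hx.2))
    (fun x hx hne => cardDensity_nonneg hb (Ioo_subset_Icc_self hx) fun h => hne
      (by rw [h, xOf_xInv hx.1.le]))
  have h0 : positionCDF b 0 = 0 := by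
    rw [positionCDF_eq hb (left_mem_Icc.2 zero_le_one), xInv_zero, flow_zero_right hb.1]
  refine ⟨h.1, fun x hx => ?_⟩
  rw [h.2 x hx, h0, sub_zero]

/-! ### The density of the number of the card in a position -/

/-- The distribution function of the limiting rescaled number of the card around position `x * n`. -/
noncomputable def cardCDF (x b : ℝ) : ℝ :=
  if b ≤ xInv x then (Real.exp b - 1) * (Real.exp 1 - Real.exp (1 - xInv x))⁻¹
  else Real.exp (b - 1)

/-- `e^b - 1 = e^(b-1) (e - e^(1-b))`. Hence the two branches of `cardCDF` agree at `b = xInv x`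
when `x > 0`; for `x = 0` they do not. -/
theorem cardCDF_join {b : ℝ} (hb : 0 < b) :
    (Real.exp b - 1) * (Real.exp 1 - Real.exp (1 - b))⁻¹ = Real.exp (b - 1) := by
  have h := deriv_xOf_pos hb
  rw [← div_eq_mul_inv, div_eq_iff h.ne', mul_sub, ← Real.exp_add, ← Real.exp_add]
  rw [show b - 1 + 1 = b by ring, show b - 1 + (1 - b) = 0 by ring, Real.exp_zero]

theorem cardCDF_zero_right {x : ℝ} (hx : 0 ≤ x) : cardCDF x 0 = 0 := by
  rw [cardCDF, if_pos (xInv_nonneg hx)]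
  simp

theorem cardCDF_one_right {x : ℝ} (hx : x ∈ Icc (0 : ℝ) 1) : cardCDF x 1 = 1 := by
  unfold cardCDF
  split_ifs with h
  · rw [le_antisymm (xInv_le_one hx.1 hx.2) h, cardCDF_join one_pos]; simp
  · simp

theorem continuous_cardCDF {x : ℝ} (hx : 0 < x) : Continuous (cardCDF x) := by
  refine Continuous.if_le (by fun_prop) (by fun_prop) continuous_id continuous_const ?_
  rintro b rfl
  exact cardCDF_join (xInv_pos hx)

/-- The link between the two descriptions: `cardDensity` is defined by differentiating `F_b` in `x`,
and is here the derivative in `b` of the law of the card number. -/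
theorem hasDerivAt_cardCDF {x b : ℝ} (hx : x ∈ Icc (0 : ℝ) 1) (hb : b ∈ Icc (0 : ℝ) 1)
    (h : b ≠ xInv x) : HasDerivAt (cardCDF x) (cardDensity x b) b := by
  rcases lt_or_gt_of_ne h with h | h
  · rw [cardDensity_of_lt hb hx h]
    refine (((Real.hasDerivAt_exp b).sub_const 1).mul_const _).congr_of_eventuallyEq ?_
    filter_upwards [Iio_mem_nhds h] with c hc
    rw [cardCDF, if_pos (le_of_lt hc)]
  · rw [cardDensity_of_gt hb hx h]
    have h1 : HasDerivAt (fun c : ℝ => Real.exp (c - 1)) (Real.exp (b - 1)) b := by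
      simpa using ((hasDerivAt_id b).sub_const 1).exp
    refine h1.congr_of_eventuallyEq ?_
    filter_upwards [Ioi_mem_nhds h] with c hc
    rw [cardCDF, if_neg (not_le.2 hc)]

theorem integral_cardDensity {x : ℝ} (hx : x ∈ Ioc (0 : ℝ) 1) :
    IntegrableOn (cardDensity x) (Icc 0 1) ∧
      ∀ b ∈ Icc (0 : ℝ) 1, ∫ t in (0 : ℝ)..b, cardDensity x t = cardCDF x b := by
  have hx' := Ioc_subset_Icc_self hx
  have h := integrableOn_and_integral_eq_of_hasDerivAt_of_ne (f := cardCDF x)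
    (f' := cardDensity x) (p := xInv x) ⟨xInv_nonneg hx.1.le, xInv_le_one hx.1.le hx.2⟩
    (continuous_cardCDF hx.1).continuousOn
    (fun b hb hne => hasDerivAt_cardCDF hx' (Ioo_subset_Icc_self hb) hne)
    (fun b hb hne => cardDensity_nonneg (Ioo_subset_Icc_self hb) hx' hne)
  refine ⟨h.1, fun b hb => ?_⟩
  rw [h.2 b hb, cardCDF_zero_right hx.1.le, sub_zero]

theorem cardDensity_zero_left {b : ℝ} (hb : b ∈ Ioc (0 : ℝ) 1) :
    cardDensity 0 b = Real.exp (b - 1) :=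
  cardDensity_of_gt (Ioc_subset_Icc_self hb) (left_mem_Icc.2 zero_le_one)
    (by rw [xInv_zero]; exact hb.1)

/-- `cardCDF 0` is discontinuous at `0`, so the continuous antiderivative `e^(b-1)` takes its place;
its value `e⁻¹` at `0` is the mass that the density lacks. -/
theorem integral_cardDensity_zero_left :
    IntegrableOn (cardDensity 0) (Icc 0 1) ∧
      ∀ b ∈ Icc (0 : ℝ) 1,
        ∫ t in (0 : ℝ)..b, cardDensity 0 t = Real.exp (b - 1) - Real.exp (-1) := by
  have h := integrableOn_and_integral_eq_of_hasDerivAt_of_ne (f := fun b : ℝ => Real.exp (b - 1))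
    (f' := cardDensity 0) (p := 0) ⟨le_rfl, zero_le_one⟩ (by fun_prop)
    (fun b hb _ => by
      rw [cardDensity_zero_left (Ioo_subset_Ioc_self hb)]
      simpa using ((hasDerivAt_id b).sub_const 1).exp)
    (fun b hb _ => by
      rw [cardDensity_zero_left (Ioo_subset_Ioc_self hb)]
      positivity)
  refine ⟨h.1, fun b hb => ?_⟩
  rw [h.2 b hb, zero_sub]

theorem ae_cardDensity_nonneg {x : ℝ} (hx : x ∈ Icc (0 : ℝ) 1) :
    ∀ᵐ b ∂(volume.restrict (Icc (0 : ℝ) 1)), 0 ≤ cardDensity x b := by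
  filter_upwards [ae_restrict_mem measurableSet_Icc,
    ae_restrict_of_ae (Measure.ae_ne volume (xInv x))] with b hb hne
  exact cardDensity_nonneg hb hx hne

theorem densityMeasure_apply {x : ℝ} (hx : x ∈ Icc (0 : ℝ) 1)
    (hint : IntegrableOn (cardDensity x) (Icc 0 1)) {s : Set ℝ} (hs : MeasurableSet s) :
    densityMeasure x s = ENNReal.ofReal (∫ b in s ∩ Icc 0 1, cardDensity x b) := by
  rw [densityMeasure, withDensity_apply _ hs, Measure.restrict_restrict hs,
    ofReal_integral_eq_lintegral_ofReal (hint.mono_set inter_subset_right)]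
  exact ae_restrict_of_ae_restrict_of_subset inter_subset_right (ae_cardDensity_nonneg hx)

theorem densityMeasure_Iic {x b : ℝ} (hx : x ∈ Icc (0 : ℝ) 1) (hb : b ∈ Icc (0 : ℝ) 1)
    (hint : IntegrableOn (cardDensity x) (Icc 0 1)) :
    densityMeasure x (Iic b) = ENNReal.ofReal (∫ t in (0 : ℝ)..b, cardDensity x t) := by
  have : Iic b ∩ Icc (0 : ℝ) 1 = Icc 0 b := by
    ext c
    simp only [mem_inter_iff, mem_Iic, mem_Icc]
    exact ⟨fun h => ⟨h.2.1, h.1⟩, fun h => ⟨h.2, h.1, h.2.trans hb.2⟩⟩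
  rw [densityMeasure_apply hx hint measurableSet_Iic, intervalIntegral.integral_of_le hb.1,
    ← integral_Icc_eq_integral_Ioc, this]

theorem densityMeasure_univ {x : ℝ} (hx : x ∈ Icc (0 : ℝ) 1)
    (hint : IntegrableOn (cardDensity x) (Icc 0 1)) :
    densityMeasure x univ = ENNReal.ofReal (∫ t in (0 : ℝ)..1, cardDensity x t) := by
  rw [densityMeasure_apply hx hint MeasurableSet.univ, univ_inter,
    intervalIntegral.integral_of_le zero_le_one, ← integral_Icc_eq_integral_Ioc]

theorem densityMeasure_Iic_of_neg {x b : ℝ} (hb : b < 0) : densityMeasure x (Iic b) = 0 := by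
  rw [densityMeasure, withDensity_apply _ measurableSet_Iic,
    Measure.restrict_restrict measurableSet_Iic]
  have : Iic b ∩ Icc (0 : ℝ) 1 = ∅ := by
    ext c
    simp only [mem_inter_iff, mem_Iic, mem_Icc, mem_empty_iff_false, iff_false]
    rintro ⟨h1, h2, -⟩
    linarith
  rw [this, Measure.restrict_empty, lintegral_zero_measure]

/-! ### The limiting number of cards `≤ b * n` in the positions `≤ x * n` -/

/-- The limiting proportion of the deck that consists of the cards with number at most `b * n` in a
position at most `x * n`. -/
noncomputable def jointCDF (b x : ℝ) : ℝ := flow b (xInv x) - max (xInv x - b) 0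

theorem jointCDF_of_le {b x : ℝ} (hb : 0 ≤ b) (hx : 0 ≤ x) (h : x ≤ xOf b) :
    jointCDF b x = x * Real.exp (b - 1) := by
  have h' := (xInv_le_iff hx hb).2 h
  rw [jointCDF, flow_of_le h', xOf_xInv hx, max_eq_right (by linarith), sub_zero]

theorem jointCDF_of_ge {b x : ℝ} (hb : 0 ≤ b) (hx : 0 ≤ x) (h : xOf b ≤ x) :
    jointCDF b x = 1 - (1 - xInv x) * Real.exp b - (xInv x - b) := by
  have h' := (le_xInv_iff hx hb).2 h
  rw [jointCDF, flow_of_ge h', max_eq_left (by linarith)]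

/-- Unlike `F_b`, this function has equal one-sided slopes at `x = xOf b > 0`, by `cardCDF_join`, so
no exceptional point is left there. The case `b = x = 0` is set aside because the derivative of
`xOf` vanishes at `0`, which makes the slope of `xInv` infinite. -/
theorem hasDerivWithinAt_jointCDF {b x : ℝ} (hb : 0 ≤ b) (hx : 0 ≤ x) (h : 0 < b ∨ 0 < x) :
    HasDerivWithinAt (jointCDF b) (cardCDF x b) (Ici 0) x := by
  have hlin : HasDerivAt (fun y : ℝ => y * Real.exp (b - 1)) (Real.exp (b - 1)) x := by
    simpa using (hasDerivAt_id x).mul_const (Real.exp (b - 1))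
  have hinv : 0 < x → HasDerivAt (fun y : ℝ => 1 - (1 - xInv y) * Real.exp b - (xInv y - b))
      ((Real.exp b - 1) * (Real.exp 1 - Real.exp (1 - xInv x))⁻¹) x := fun h0 => by
    convert! ((((hasDerivAt_xInv h0).const_sub 1).mul_const (Real.exp b)).const_sub 1).sub
      ((hasDerivAt_xInv h0).sub_const b) using 1
    ring
  rcases lt_trichotomy x (xOf b) with hlt | heq | hgt
  · rw [cardCDF, if_neg (not_le.2 ((xInv_lt_iff hx hb).2 hlt))]
    refine hlin.hasDerivWithinAt.congr_of_eventuallyEq ?_ (jointCDF_of_le hb hx hlt.le)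
    filter_upwards [self_mem_nhdsWithin, mem_nhdsWithin_of_mem_nhds (Iio_mem_nhds hlt)] with y hy hy'
    exact jointCDF_of_le hb hy (le_of_lt hy')
  · have hbx : xInv x = b := by rw [heq, xInv_xOf hb]
    have hb0 : 0 < b := by
      rcases h with h | h
      · exact h
      · rw [← hbx]; exact xInv_pos h
    have hx0 : 0 < x := by
      have := strictMonoOn_xOf self_mem_Ici hb hb0
      rwa [xOf_zero, ← heq] at this
    have h2 := hinv hx0
    rw [cardCDF, if_pos hbx.ge]
    have hval : (Real.exp b - 1) * (Real.exp 1 - Real.exp (1 - xInv x))⁻¹ = Real.exp (b - 1) := by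
      rw [hbx, cardCDF_join hb0]
    rw [hval] at h2 ⊢
    have h3 : HasDerivWithinAt (jointCDF b) (Real.exp (b - 1)) (Icc 0 x) x :=
      hlin.hasDerivWithinAt.congr (fun y hy => jointCDF_of_le hb hy.1 (heq ▸ hy.2))
        (jointCDF_of_le hb hx heq.le)
    have h4 : HasDerivWithinAt (jointCDF b) (Real.exp (b - 1)) (Ici x) x :=
      h2.hasDerivWithinAt.congr
        (fun y hy => jointCDF_of_ge hb (hx.trans hy) (heq ▸ hy)) (jointCDF_of_ge hb hx heq.ge)
    have h5 := h3.union h4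
    rwa [Icc_union_Ici_eq_Ici hx] at h5
  · rw [cardCDF, if_pos ((le_xInv_iff hx hb).2 hgt.le)]
    have hx0 : 0 < x := (xOf_nonneg hb).trans_lt hgt
    refine (hinv hx0).hasDerivWithinAt.congr_of_eventuallyEq ?_ (jointCDF_of_ge hb hx hgt.le)
    filter_upwards [self_mem_nhdsWithin, mem_nhdsWithin_of_mem_nhds (Ioi_mem_nhds hgt)] with y hy hy'
    exact jointCDF_of_ge hb hy (le_of_lt hy')

/-! ### Cards in a window of positions -/

/-- The probability that the card in position `k` has a number that is at most `b * n`. -/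
noncomputable def cardProb (n : ℕ) (b : ℝ) (k : ℕ) : ℝ :=
  shuffleProb n (fun deck => (cardAt deck k : ℝ) ≤ b * n)

theorem cardProb_nonneg (n : ℕ) (b : ℝ) (k : ℕ) : 0 ≤ cardProb n b k := by
  classical
  rw [cardProb, shuffleProb_eq_mean]
  exact mean_nonneg fun w => by split_ifs <;> norm_num

theorem cardProb_le_one {n : ℕ} (hn : 0 < n) (b : ℝ) (k : ℕ) : cardProb n b k ≤ 1 := by
  classical
  rw [cardProb, shuffleProb_eq_mean]
  refine (mean_mono (g := fun _ => 1) fun w => ?_).trans_eq (mean_const hn 1)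
  split_ifs <;> norm_num

/-- Allows the random final position of the marker to be replaced by `⌊x * n⌋₊`, at a cost equal to
their distance. -/
theorem abs_card_filter_Icc_sub_le (p : ℕ → Prop) [DecidablePred p] (K L : ℕ) :
    |(((Finset.Icc 1 K).filter p).card : ℝ) - ((Finset.Icc 1 L).filter p).card| ≤
      |(K : ℝ) - L| := by
  wlog h : K ≤ L generalizing K L
  · rw [abs_sub_comm, abs_sub_comm (K : ℝ)]
    exact this L K (by omega)
  have h1 : ((Finset.Icc 1 K).filter p).card ≤ ((Finset.Icc 1 L).filter p).card :=
    Finset.card_le_card (Finset.filter_subset_filter _ (Finset.Icc_subset_Icc_right h))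
  have h2 : ((Finset.Icc 1 L).filter p).card ≤ ((Finset.Icc 1 K).filter p).card + (L - K) := by
    have hsub : (Finset.Icc 1 L).filter p ⊆ (Finset.Icc 1 K).filter p ∪ Finset.Ioc K L := by
      intro k
      simp only [Finset.mem_filter, Finset.mem_Icc, Finset.mem_union, Finset.mem_Ioc]
      intro hk
      by_cases hkK : k ≤ K
      · exact Or.inl ⟨⟨hk.1.1, hkK⟩, hk.2⟩
      · exact Or.inr ⟨by omega, hk.1.2⟩
    refine (Finset.card_le_card hsub).trans ((Finset.card_union_le _ _).trans ?_)
    rw [Nat.card_Ioc]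
  have h1' : (((Finset.Icc 1 K).filter p).card : ℝ) ≤ ((Finset.Icc 1 L).filter p).card := by
    exact_mod_cast h1
  have h2' : (((Finset.Icc 1 L).filter p).card : ℝ) ≤
      ((Finset.Icc 1 K).filter p).card + ((L : ℝ) - K) := by
    rw [← Nat.cast_sub h]; exact_mod_cast h2
  have h3 : (K : ℝ) ≤ L := by exact_mod_cast h
  rw [abs_sub_comm, abs_sub_comm (K : ℝ), abs_of_nonneg (by linarith), abs_of_nonneg (by linarith)]
  linarith

theorem sum_cardProb_eq_mean {n : ℕ} {b : ℝ} (hb : 0 ≤ b) (K : ℕ) :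
    ∑ k ∈ Finset.Icc 1 K, cardProb n b k = mean n (fun w =>
      (((Finset.Icc 1 K).filter (fun k => cardAt (finalDeck n w) k ≤ ⌊b * n⌋₊)).card : ℝ)) := by
  classical
  have hbn : 0 ≤ b * n := mul_nonneg hb (Nat.cast_nonneg n)
  simp only [cardProb, shuffleProb_eq_mean, ← mean_sum, Finset.sum_boole, Nat.le_floor_iff hbn]

theorem mean_card_le_marker {n m J : ℕ} (hm : m ≤ n) (hJ : J ≤ n) (hn : 0 < n) :
    mean n (fun w => (((Finset.Icc 1 (marker m w n)).filter
      (fun k => cardAt (finalDeck n w) k ≤ J)).card : ℝ)) =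
      meanMarker n m J - ((m - J : ℕ) : ℝ) := by
  rw [← mean_marker hm hJ hn, eq_sub_iff_add_eq, ← mean_const (n := n) hn ((m - J : ℕ) : ℝ),
    ← mean_add]
  congr 1
  funext w
  exact_mod_cast card_cardAt_le_marker hm hJ w

/-- The mean count up to the marker laid at `xInv x * n` is known exactly from
`mean_card_le_marker`, and this marker finishes within `o(n)` of `x * n` in mean. -/
theorem tendsto_sum_cardProb {b x : ℝ} (hb : b ∈ Icc (0 : ℝ) 1) (hx : x ∈ Icc (0 : ℝ) 1) :
    Tendsto (fun n : ℕ => (∑ k ∈ Finset.Icc 1 ⌊x * n⌋₊, cardProb n b k) / n) atTop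
      (𝓝 (jointCDF b x)) := by
  have hβ0 := xInv_nonneg hx.1
  have hβ1 := xInv_le_one hx.1 hx.2
  have hm := tendsto_floor_mul_div hβ0
  have hJ := tendsto_floor_mul_div hb.1
  have h1 : Tendsto (fun n : ℕ => (meanMarker n ⌊xInv x * n⌋₊ ⌊b * n⌋₊ -
      ((⌊xInv x * n⌋₊ - ⌊b * n⌋₊ : ℕ) : ℝ)) / n) atTop (𝓝 (jointCDF b x)) := by
    simp only [sub_div]
    refine (tendsto_meanMarker hm hJ).sub ?_
    refine ((hm.sub hJ).max tendsto_const_nhds).congr fun n => ?_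
    rcases le_total ⌊b * n⌋₊ ⌊xInv x * n⌋₊ with h | h
    · rw [Nat.cast_sub h, ← sub_div, max_eq_left]
      have : (⌊b * n⌋₊ : ℝ) ≤ ⌊xInv x * n⌋₊ := by exact_mod_cast h
      exact div_nonneg (by linarith) (Nat.cast_nonneg n)
    · rw [Nat.sub_eq_zero_of_le h, ← sub_div, max_eq_right]
      · simp
      · have : (⌊xInv x * n⌋₊ : ℝ) ≤ ⌊b * n⌋₊ := by exact_mod_cast h
        exact div_nonpos_of_nonpos_of_nonneg (by linarith) (Nat.cast_nonneg n)
  have h2 := tendsto_mean_abs_marker_sub (floor_mul_le hβ1) hβ1 hm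
  rw [xOf_xInv hx.1] at h2
  have h3 : Tendsto (fun n : ℕ => |(⌊x * n⌋₊ : ℝ) / n - x|) atTop (𝓝 0) := by
    simpa using ((tendsto_floor_mul_div hx.1).sub_const x).abs
  have h4 := h3.add h2
  rw [add_zero] at h4
  have h5 : Tendsto (fun n : ℕ => (∑ k ∈ Finset.Icc 1 ⌊x * n⌋₊, cardProb n b k) / n -
      (meanMarker n ⌊xInv x * n⌋₊ ⌊b * n⌋₊ - ((⌊xInv x * n⌋₊ - ⌊b * n⌋₊ : ℕ) : ℝ)) / n) atTop
      (𝓝 0) := by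
    refine squeeze_zero_norm' ?_ h4
    filter_upwards [eventually_gt_atTop 0] with n hn
    have hn' : (0 : ℝ) < n := by positivity
    rw [sum_cardProb_eq_mean hb.1, ← mean_card_le_marker (floor_mul_le hβ1 n)
      (floor_mul_le hb.2 n) hn, ← sub_div, ← mean_sub, ← mean_div_const, Real.norm_eq_abs]
    refine (abs_mean_le _).trans ?_
    rw [← mean_const (n := n) hn |(⌊x * n⌋₊ : ℝ) / n - x|, ← mean_add]
    refine mean_mono fun w => ?_
    rw [abs_div, abs_of_pos hn', abs_sub_comm ((marker _ w n : ℝ) / n)]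
    refine (div_le_div_of_nonneg_right (abs_card_filter_Icc_sub_le _ _ _) hn'.le).trans ?_
    refine le_trans (le_of_eq ?_) (abs_add_le _ _)
    rw [← abs_of_pos hn', ← abs_div, abs_of_pos hn']
    congr 1
    ring
  simpa using h5.add h1

theorem mem_window {n k : ℕ} (hn : 0 < n) {x ε : ℝ} (hx : x + ε ≥ 0) :
    k ∈ window n x ε ↔ 1 ≤ k ∧ (max (x - ε) 0) * n ≤ k ∧ k ≤ ⌊min (x + ε) 1 * n⌋₊ := by
  have hn' : (0 : ℝ) < n := by positivity
  have h0 : 0 ≤ min (x + ε) 1 * n := mul_nonneg (le_min hx zero_le_one) hn'.le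
  have hk : (k : ℝ) ≤ n ↔ k ≤ n := Nat.cast_le
  rw [window, Finset.mem_filter, Finset.mem_Icc, Nat.le_floor_iff h0, ← le_div_iff₀ hn',
    ← div_le_iff₀ hn', le_min_iff, max_le_iff, div_le_one hn', hk, abs_le]
  have h1 : (0 : ℝ) ≤ k / n := by positivity
  constructor
  · rintro ⟨⟨a, b⟩, c, d⟩
    exact ⟨a, ⟨by linarith, h1⟩, by linarith, b⟩
  · rintro ⟨a, ⟨c, -⟩, d, b⟩
    exact ⟨⟨a, b⟩, by linarith, by linarith⟩

/-- A sum over a window is, up to one term, a difference of sums over initial segments. -/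
theorem abs_sum_window_sub_le {n : ℕ} (hn : 0 < n) {x ε : ℝ} (hx : x ∈ Icc (0 : ℝ) 1)
    (hε : 0 < ε) {f : ℕ → ℝ} (h0 : ∀ k, 0 ≤ f k) (h1 : ∀ k, f k ≤ 1) :
    |∑ k ∈ window n x ε, f k - (∑ k ∈ Finset.Icc 1 ⌊min (x + ε) 1 * n⌋₊, f k -
      ∑ k ∈ Finset.Icc 1 ⌊max (x - ε) 0 * n⌋₊, f k)| ≤ 1 := by
  have hn' : (0 : ℝ) < n := by positivity
  have hzz : max (x - ε) 0 ≤ min (x + ε) 1 :=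
    (max_le (by linarith) hx.1).trans (le_min (by linarith [hx.2]) hx.2)
  have hxε : x + ε ≥ 0 := by linarith [hx.1]
  have hz0 : 0 ≤ max (x - ε) 0 * n := mul_nonneg (le_max_right _ _) hn'.le
  have hAB : ⌊max (x - ε) 0 * n⌋₊ ≤ ⌊min (x + ε) 1 * n⌋₊ :=
    Nat.floor_le_floor (mul_le_mul_of_nonneg_right hzz hn'.le)
  have hmem : ∀ k, k ∈ window n x ε ↔ _ := fun k => mem_window hn hxε
  set A := ⌊max (x - ε) 0 * n⌋₊ with hA
  set B := ⌊min (x + ε) 1 * n⌋₊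
  have hdiff : ∑ k ∈ Finset.Icc 1 B, f k - ∑ k ∈ Finset.Icc 1 A, f k = ∑ k ∈ Finset.Ioc A B, f k := by
    rw [sub_eq_iff_eq_add', ← Finset.sum_union]
    · congr 1
      ext k
      simp only [Finset.mem_union, Finset.mem_Icc, Finset.mem_Ioc]
      omega
    · rw [Finset.disjoint_left]
      intro k
      simp only [Finset.mem_Icc, Finset.mem_Ioc]
      omega
  have hsub : Finset.Ioc A B ⊆ window n x ε := by
    intro k hk
    rw [Finset.mem_Ioc] at hk
    exact (hmem k).2 ⟨by omega, (Nat.lt_of_floor_lt hk.1).le, hk.2⟩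
  -- The window is closed on the left, so it contains `A` too if the left end is itself a positive
  -- integer.
  have hsub' : window n x ε ⊆ insert A (Finset.Ioc A B) := by
    intro k hk
    obtain ⟨_, k2, k3⟩ := (hmem k).1 hk
    have : A ≤ k := by
      have := (Nat.floor_le hz0).trans k2
      exact_mod_cast this
    rw [Finset.mem_insert, Finset.mem_Ioc]
    omega
  rw [hdiff]
  have e1 := Finset.sum_le_sum_of_subset_of_nonneg hsub (f := f) fun k _ _ => h0 k
  have e2 := Finset.sum_le_sum_of_subset_of_nonneg hsub' (f := f) fun k _ _ => h0 k
  rw [Finset.sum_insert (by simp)] at e2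
  have := h1 A
  rw [abs_le]
  constructor <;> linarith

/-- Stated for general `f` because it serves the numerator of `windowCDF`, with `cardProb`, and the
denominator, with the constant `1`. -/
theorem tendsto_sum_window {x ε : ℝ} (hx : x ∈ Icc (0 : ℝ) 1) (hε : 0 < ε)
    {f : ℕ → ℕ → ℝ} (h0 : ∀ n k, 0 ≤ f n k) (h1 : ∀ n k, 0 < n → f n k ≤ 1) {g : ℝ → ℝ}
    (hf : ∀ z ∈ Icc (0 : ℝ) 1,
      Tendsto (fun n : ℕ => (∑ k ∈ Finset.Icc 1 ⌊z * n⌋₊, f n k) / n) atTop (𝓝 (g z))) :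
    Tendsto (fun n : ℕ => (∑ k ∈ window n x ε, f n k) / n) atTop
      (𝓝 (g (min (x + ε) 1) - g (max (x - ε) 0))) := by
  have hz1 : max (x - ε) 0 ∈ Icc (0 : ℝ) 1 :=
    ⟨le_max_right _ _, max_le (by linarith [hx.2]) zero_le_one⟩
  have hz2 : min (x + ε) 1 ∈ Icc (0 : ℝ) 1 :=
    ⟨le_min (by linarith [hx.1]) zero_le_one, min_le_right _ _⟩
  have h := (hf _ hz2).sub (hf _ hz1)
  have h' : Tendsto (fun n : ℕ => (∑ k ∈ window n x ε, f n k) / n -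
      ((∑ k ∈ Finset.Icc 1 ⌊min (x + ε) 1 * n⌋₊, f n k) / n -
      (∑ k ∈ Finset.Icc 1 ⌊max (x - ε) 0 * n⌋₊, f n k) / n)) atTop (𝓝 0) := by
    refine squeeze_zero_norm' ?_ (tendsto_one_div_atTop_nhds_zero_nat (𝕜 := ℝ))
    filter_upwards [eventually_gt_atTop 0] with n hn
    have hn' : (0 : ℝ) < n := by positivity
    rw [← sub_div, ← sub_div, Real.norm_eq_abs, abs_div, abs_of_pos hn']
    exact div_le_div_of_nonneg_right
      (abs_sum_window_sub_le hn hx hε (h0 n) fun k => h1 n k hn) hn'.le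
  simpa using h'.add h

theorem window_length_pos {x ε : ℝ} (hx : x ∈ Icc (0 : ℝ) 1) (hε : 0 < ε) :
    0 < min (x + ε) 1 - max (x - ε) 0 := by
  rw [sub_pos, max_lt_iff, lt_min_iff, lt_min_iff]
  have := hx.1
  have := hx.2
  refine ⟨⟨by linarith, by linarith⟩, by linarith, by linarith⟩

theorem tendsto_card_window {x ε : ℝ} (hx : x ∈ Icc (0 : ℝ) 1) (hε : 0 < ε) :
    Tendsto (fun n : ℕ => ((window n x ε).card : ℝ) / n) atTop
      (𝓝 (min (x + ε) 1 - max (x - ε) 0)) := by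
  have h := tendsto_sum_window hx hε (f := fun _ _ => 1) (g := fun z => z)
    (fun _ _ => zero_le_one) (fun _ _ _ => le_rfl) (fun z hz => by
      simpa using tendsto_floor_mul_div hz.1)
  simpa using h

theorem eventually_card_window_pos {x ε : ℝ} (hx : x ∈ Icc (0 : ℝ) 1) (hε : 0 < ε) :
    ∀ᶠ n : ℕ in atTop, 0 < (window n x ε).card := by
  filter_upwards [(tendsto_card_window hx hε).eventually (lt_mem_nhds (window_length_pos hx hε))]
    with n hn
  refine Nat.pos_of_ne_zero fun h => ?_
  rw [h] at hn
  simp at hn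

theorem tendsto_windowCDF {x ε b : ℝ} (hx : x ∈ Icc (0 : ℝ) 1) (hε : 0 < ε)
    (hb : b ∈ Icc (0 : ℝ) 1) :
    Tendsto (fun n : ℕ => windowCDF n x ε b) atTop
      (𝓝 ((jointCDF b (min (x + ε) 1) - jointCDF b (max (x - ε) 0)) /
        (min (x + ε) 1 - max (x - ε) 0))) := by
  have h := (tendsto_sum_window hx hε (fun n k => cardProb_nonneg n b k)
    (fun n k hn => cardProb_le_one hn b k) (fun z hz => tendsto_sum_cardProb hb hz)).div
    (tendsto_card_window hx hε) (window_length_pos hx hε).ne'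
  refine h.congr' ?_
  filter_upwards [eventually_gt_atTop 0] with n hn
  have hn' : (n : ℝ) ≠ 0 := by positivity
  rw [Pi.div_apply, div_div_div_cancel_right₀ hn']
  rfl

theorem windowCDF_of_neg {n : ℕ} (hn : 0 < n) {x ε b : ℝ} (hb : b < 0) :
    windowCDF n x ε b = 0 := by
  classical
  have hn' : (0 : ℝ) < n := by positivity
  have h : ∀ deck k, ¬ ((cardAt deck k : ℝ) ≤ b * n) := fun deck k => by
    have := mul_neg_of_neg_of_pos hb hn'
    have h2 : (0 : ℝ) ≤ cardAt deck k := Nat.cast_nonneg _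
    linarith
  simp [windowCDF, shuffleProb, h]

theorem windowCDF_of_one_le {n : ℕ} (hn : 0 < n) {x ε b : ℝ} (hb : 1 ≤ b)
    (hw : 0 < (window n x ε).card) : windowCDF n x ε b = 1 := by
  classical
  have hn' : (0 : ℝ) < n := by positivity
  have h : ∀ k ∈ window n x ε,
      shuffleProb n (fun deck => (cardAt deck k : ℝ) ≤ b * n) = 1 := fun k hk => by
    rw [window, Finset.mem_filter, Finset.mem_Icc] at hk
    rw [shuffleProb_eq_mean]
    refine Eq.trans ?_ (mean_const hn 1)
    congr 1
    funext w
    rw [if_pos]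
    have hlen : (finalDeck n w).length = n := by simpa using (finalDeck_perm w).length_eq
    have hk' : k - 1 < (finalDeck n w).length := by omega
    have hcard : cardAt (finalDeck n w) k = (finalDeck n w)[k - 1] := by simp [cardAt, hk']
    have hle : (finalDeck n w)[k - 1] ≤ n := by
      have := (finalDeck_perm w).mem_iff.1 (List.getElem_mem hk')
      rw [List.mem_range'_1] at this
      omega
    have hle' : (cardAt (finalDeck n w) k : ℝ) ≤ n := by rw [hcard]; exact_mod_cast hle
    nlinarith
  rw [windowCDF, Finset.sum_congr rfl h]
  have : ((window n x ε).card : ℝ) ≠ 0 := by positivity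
  simp [this]

/-- A difference quotient over an interval around the point approximates the derivative there. -/
theorem exists_abs_slope_sub_lt {g : ℝ → ℝ} {g' x : ℝ} (hx : x ∈ Icc (0 : ℝ) 1)
    (hg : HasDerivWithinAt g g' (Ici 0) x) {η : ℝ} (hη : 0 < η) :
    ∃ ε₀ > 0, ∀ ε ∈ Ioo 0 ε₀, |(g (min (x + ε) 1) - g (max (x - ε) 0)) /
      (min (x + ε) 1 - max (x - ε) 0) - g'| < η := by
  have h := hg.isLittleO.def (half_pos hη)
  rw [eventually_nhdsWithin_iff, Metric.eventually_nhds_iff] at h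
  obtain ⟨ε₀, hε₀, h⟩ := h
  refine ⟨ε₀, hε₀, fun ε hε => ?_⟩
  have hlen := window_length_pos hx hε.1
  have ha : max (x - ε) 0 ≤ x := max_le (by linarith [hε.1]) hx.1
  have hb : x ≤ min (x + ε) 1 := le_min (by linarith [hε.1]) hx.2
  have ha' : x - ε ≤ max (x - ε) 0 := le_max_left _ _
  have hb' : min (x + ε) 1 ≤ x + ε := min_le_left _ _
  have ha0 : 0 ≤ max (x - ε) 0 := le_max_right _ _
  generalize max (x - ε) 0 = y at *
  generalize min (x + ε) 1 = z at *
  have h1 := @h y (by rw [Real.dist_eq, abs_lt]; constructor <;> linarith [hε.2, hε.1]) ha0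
  have h2 := @h z (by rw [Real.dist_eq, abs_lt]; constructor <;> linarith [hε.2, hε.1])
    (show (0 : ℝ) ≤ z by linarith)
  simp only [smul_eq_mul, Real.norm_eq_abs] at h1 h2
  rw [abs_of_nonpos (show y - x ≤ 0 by linarith), abs_le] at h1
  rw [abs_of_nonneg (show 0 ≤ z - x by linarith), abs_le] at h2
  rw [div_sub' hlen.ne', abs_div, abs_of_pos hlen, div_lt_iff₀ hlen, abs_lt]
  -- The errors on the two sides of `x` add up to at most `η/2` times the full length `z - y`,
  -- whether or not one side is degenerate.
  constructor <;> nlinarith [mul_pos hη hlen]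

/-- For `b` outside `[0, 1]` the window probabilities are eventually exactly `0` or `1`; inside they
converge, as `n → ∞`, to a difference quotient of `jointCDF b`. -/
theorem isLimitingCardLaw_of_cdf {x : ℝ} (hx : x ∈ Icc (0 : ℝ) 1) {μ : Measure ℝ}
    (hμ : IsProbabilityMeasure μ) (hneg : ∀ b < 0, μ (Iic b) = 0) (hone : μ (Iic 1) = 1)
    (hcdf : ∀ b ∈ Icc (0 : ℝ) 1, μ {b} = 0 → (0 < b ∨ 0 < x) ∧ μ.real (Iic b) = cardCDF x b) :
    IsLimitingCardLaw x μ := by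
  refine ⟨hμ, fun b hb η hη => ?_⟩
  rcases lt_or_ge b 0 with hb0 | hb0
  · refine ⟨1, one_pos, fun ε hε => ?_⟩
    filter_upwards [eventually_gt_atTop 0] with n hn
    rw [windowCDF_of_neg hn hb0, measureReal_def, hneg b hb0]
    simpa using hη
  rcases le_or_gt b 1 with hb1 | hb1
  · obtain ⟨hpos, hval⟩ := hcdf b ⟨hb0, hb1⟩ hb
    obtain ⟨ε₀, hε₀, h⟩ := exists_abs_slope_sub_lt hx
      (hasDerivWithinAt_jointCDF hb0 hx.1 hpos) hη
    refine ⟨ε₀, hε₀, fun ε hε => ?_⟩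
    rw [hval]
    exact ((tendsto_windowCDF hx hε.1 ⟨hb0, hb1⟩).sub_const _).abs.eventually
      (gt_mem_nhds (h ε hε))
  · refine ⟨1, one_pos, fun ε hε => ?_⟩
    have hval : μ (Iic b) = 1 :=
      le_antisymm prob_le_one (hone ▸ measure_mono (Iic_subset_Iic.2 hb1.le))
    filter_upwards [eventually_gt_atTop 0, eventually_card_window_pos hx hε.1] with n hn hw
    rw [windowCDF_of_one_le hn hb1.le hw, measureReal_def, hval]
    simpa using hη

theorem isLimitingCardLaw_densityMeasure {x : ℝ} (hx : x ∈ Ioc (0 : ℝ) 1) :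
    IsLimitingCardLaw x (densityMeasure x) := by
  have hx' := Ioc_subset_Icc_self hx
  obtain ⟨hint, hcdf⟩ := integral_cardDensity hx
  have h1 : (1 : ℝ) ∈ Icc (0 : ℝ) 1 := ⟨zero_le_one, le_rfl⟩
  have hnn : ∀ b, 0 ≤ b → 0 ≤ cardCDF x b := fun b hb => by
    unfold cardCDF
    have h2 := deriv_xOf_pos (xInv_pos hx.1)
    have h3 := Real.one_le_exp hb
    split_ifs
    · exact mul_nonneg (by linarith) (by positivity)
    · positivity
  refine isLimitingCardLaw_of_cdf hx' ⟨?_⟩ (fun b hb => densityMeasure_Iic_of_neg hb) ?_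
    (fun b hb _ => ⟨Or.inr hx.1, ?_⟩)
  · rw [densityMeasure_univ hx' hint, hcdf 1 h1, cardCDF_one_right hx', ENNReal.ofReal_one]
  · rw [densityMeasure_Iic hx' h1 hint, hcdf 1 h1, cardCDF_one_right hx', ENNReal.ofReal_one]
  · rw [measureReal_def, densityMeasure_Iic hx' hb hint, hcdf b hb,
      ENNReal.toReal_ofReal (hnn b hb.1)]

theorem isLimitingCardLaw_zero :
    IsLimitingCardLaw 0
      (densityMeasure 0 + ENNReal.ofReal (Real.exp (-1)) • Measure.dirac 0) := by
  have hx : (0 : ℝ) ∈ Icc (0 : ℝ) 1 := left_mem_Icc.2 zero_le_one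
  obtain ⟨hint, hcdf⟩ := integral_cardDensity_zero_left
  have h1 : (1 : ℝ) ∈ Icc (0 : ℝ) 1 := ⟨zero_le_one, le_rfl⟩
  have he : 0 ≤ Real.exp (-1) := (Real.exp_pos _).le
  have hsub : ∀ b : ℝ, 0 ≤ b → 0 ≤ Real.exp (b - 1) - Real.exp (-1) := fun b hb => by
    rw [sub_nonneg, Real.exp_le_exp]; linarith
  have hIic : ∀ b ∈ Icc (0 : ℝ) 1,
      (densityMeasure 0 + ENNReal.ofReal (Real.exp (-1)) • Measure.dirac 0 : Measure ℝ) (Iic b) =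
        ENNReal.ofReal (Real.exp (b - 1)) := fun b hb => by
    rw [Measure.add_apply, Measure.smul_apply, Measure.dirac_apply' _ measurableSet_Iic,
      densityMeasure_Iic hx hb hint, hcdf b hb, indicator_of_mem (mem_Iic.2 hb.1), Pi.one_apply,
      smul_eq_mul, mul_one, ← ENNReal.ofReal_add (hsub b hb.1) he, sub_add_cancel]
  refine isLimitingCardLaw_of_cdf hx ⟨?_⟩ (fun b hb => ?_) ?_ (fun b hb hb0 => ?_)
  · rw [Measure.add_apply, Measure.smul_apply, densityMeasure_univ hx hint, hcdf 1 h1,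
      measure_univ, smul_eq_mul, mul_one, ← ENNReal.ofReal_add (hsub 1 zero_le_one) he,
      sub_add_cancel, sub_self, Real.exp_zero, ENNReal.ofReal_one]
  · rw [Measure.add_apply, Measure.smul_apply, Measure.dirac_apply' _ measurableSet_Iic,
      densityMeasure_Iic_of_neg hb, indicator_of_notMem (by simpa using hb)]
    simp
  · rw [hIic 1 h1, sub_self, Real.exp_zero, ENNReal.ofReal_one]
  -- The point `b = 0` carries the atom, so weak convergence asks for nothing there.
  · have hpos : 0 < b := by
      refine lt_of_le_of_ne hb.1 ?_
      rintro rfl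
      rw [Measure.add_apply, add_eq_zero, Measure.smul_apply,
        Measure.dirac_apply' _ (measurableSet_singleton _), indicator_of_mem (mem_singleton _)] at hb0
      have := hb0.2
      simp only [Pi.one_apply, smul_eq_mul, mul_one, ENNReal.ofReal_eq_zero] at this
      exact absurd this (not_le.2 (Real.exp_pos _))
    refine ⟨Or.inl hpos, ?_⟩
    rw [measureReal_def, hIic b hb, ENNReal.toReal_ofReal (Real.exp_pos _).le, cardCDF, xInv_zero,
      if_neg (not_le.2 hpos)]

/-! ### The shape of the density -/

theorem cardDensity_one_left {b : ℝ} (hb : b ∈ Ico (0 : ℝ) 1) :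
    cardDensity 1 b = Real.exp b / (Real.exp 1 - 1) := by
  rw [cardDensity_of_lt (Ico_subset_Icc_self hb) (right_mem_Icc.2 zero_le_one)
    (by rw [xInv_one]; exact hb.2), xInv_one, sub_self, Real.exp_zero, div_eq_mul_inv]

theorem tendsto_cardDensity_one_left :
    Tendsto (cardDensity 1) (𝓝[<] 1) (𝓝 (Real.exp 1 / (Real.exp 1 - 1))) := by
  have h : Tendsto (fun b : ℝ => Real.exp b / (Real.exp 1 - 1)) (𝓝[<] 1)
      (𝓝 (Real.exp 1 / (Real.exp 1 - 1))) :=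
    ((Real.continuous_exp.div_const _).tendsto 1).mono_left nhdsWithin_le_nhds
  refine h.congr' ?_
  filter_upwards [Ioo_mem_nhdsLT (zero_lt_one' ℝ)] with b hb
  exact (cardDensity_one_left (Ioo_subset_Ico_self hb)).symm

section shape

variable {x : ℝ}

theorem cardDensity_of_mem_Ico (hx : x ∈ Ioo (0 : ℝ) 1) {b : ℝ} (hb : b ∈ Ico 0 (bOf x)) :
    cardDensity x b = (Real.exp 1 - Real.exp (1 - bOf x))⁻¹ * Real.exp b := by
  rw [bOf_eq_xInv (Ioo_subset_Ico_self hx)] at *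
  have hx' := Ioo_subset_Icc_self hx
  rw [cardDensity_of_lt ⟨hb.1, hb.2.le.trans (xInv_le_one hx'.1 hx'.2)⟩ hx' hb.2, mul_comm]

theorem bOf_pos (hx : x ∈ Ioo (0 : ℝ) 1) : 0 < bOf x := by
  rw [bOf_eq_xInv (Ioo_subset_Ico_self hx)]
  exact xInv_pos hx.1

theorem cardDensity_zero_right (hx : x ∈ Ioo (0 : ℝ) 1) :
    cardDensity x 0 = Real.exp (bOf x - 1) / (Real.exp (bOf x) - 1) := by
  have hb := bOf_pos hx
  -- Writing `e^(b_x - 1)` as `(e^(b_x) - 1) / (e - e^(1 - b_x))` turns the claim into a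
  -- cancellation.
  rw [cardDensity_of_mem_Ico hx ⟨le_rfl, hb⟩, Real.exp_zero, mul_one, ← cardCDF_join hb]
  have : Real.exp (bOf x) - 1 ≠ 0 := (sub_pos.2 (Real.one_lt_exp_iff.2 hb)).ne'
  field_simp

theorem strictMonoOn_cardDensity (hx : x ∈ Ioo (0 : ℝ) 1) :
    StrictMonoOn (cardDensity x) (Ioo 0 (bOf x)) := fun b hb c hc h => by
  rw [cardDensity_of_mem_Ico hx (Ioo_subset_Ico_self hb),
    cardDensity_of_mem_Ico hx (Ioo_subset_Ico_self hc)]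
  exact mul_lt_mul_of_pos_left (Real.exp_lt_exp.2 h) (inv_pos.2 (deriv_xOf_pos (bOf_pos hx)))

theorem convexOn_cardDensity (hx : x ∈ Ioo (0 : ℝ) 1) :
    ConvexOn ℝ (Ioo 0 (bOf x)) (cardDensity x) := by
  have h := (convexOn_exp.smul (inv_pos.2 (deriv_xOf_pos (bOf_pos hx))).le).subset
    (subset_univ _) (convex_Ioo 0 (bOf x))
  exact h.congr fun b hb => (cardDensity_of_mem_Ico hx (Ioo_subset_Ico_self hb)).symm

theorem tendsto_cardDensity_bOf (hx : x ∈ Ioo (0 : ℝ) 1) :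
    Tendsto (cardDensity x) (𝓝[<] (bOf x))
      (𝓝 (Real.exp (bOf x - 1) / (1 - Real.exp (-bOf x)))) := by
  have hb := bOf_pos hx
  have hval : Real.exp (bOf x - 1) / (1 - Real.exp (-bOf x)) =
      (Real.exp 1 - Real.exp (1 - bOf x))⁻¹ * Real.exp (bOf x) := by
    have h1 : 1 - Real.exp (-bOf x) ≠ 0 := by
      rw [sub_ne_zero]
      exact (Real.exp_lt_one_iff.2 (by linarith)).ne'
    rw [inv_mul_eq_div, div_eq_div_iff h1 (deriv_xOf_pos hb).ne', mul_sub, mul_sub,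
      ← Real.exp_add, ← Real.exp_add, ← Real.exp_add]
    ring_nf
  rw [hval]
  have h : Tendsto (fun b : ℝ => (Real.exp 1 - Real.exp (1 - bOf x))⁻¹ * Real.exp b)
      (𝓝[<] (bOf x)) (𝓝 ((Real.exp 1 - Real.exp (1 - bOf x))⁻¹ * Real.exp (bOf x))) :=
    ((continuous_const.mul Real.continuous_exp).tendsto _).mono_left nhdsWithin_le_nhds
  refine h.congr' ?_
  filter_upwards [Ioo_mem_nhdsLT hb] with b hb
  exact (cardDensity_of_mem_Ico hx (Ioo_subset_Ico_self hb)).symm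

theorem cardDensity_of_mem_Ioc (hx : x ∈ Ioo (0 : ℝ) 1) {b : ℝ} (hb : b ∈ Ioc (bOf x) 1) :
    cardDensity x b = Real.exp (b - 1) := by
  have h0 := bOf_pos hx
  rw [bOf_eq_xInv (Ioo_subset_Ico_self hx)] at *
  exact cardDensity_of_gt ⟨h0.le.trans hb.1.le, hb.2⟩ (Ioo_subset_Icc_self hx) hb.1

end shape

end CardCyclic

theorem corollary5 :
    -- the limit `F_b(x)` exists for every sequence of card numbers `j n` with `j n / n → b`
    (∀ b ∈ Icc (0 : ℝ) 1, ∀ j : ℕ → ℕ, (∀ᶠ n in atTop, 1 ≤ j n ∧ j n ≤ n) →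
      Tendsto (fun n : ℕ => (j n : ℝ) / n) atTop (𝓝 b) →
      ∀ x ∈ Icc (0 : ℝ) 1,
        Tendsto (fun n : ℕ => CardCyclic.positionProb n (j n) x) atTop
          (𝓝 (CardCyclic.positionCDF b x))) ∧
    -- `f_b` is a genuine derivative off `x_b`, and is the density of `F_b`
    (∀ b ∈ Icc (0 : ℝ) 1, ∀ x ∈ Icc (0 : ℝ) 1, x ≠ CardCyclic.xOf b →
      DifferentiableWithinAt ℝ (CardCyclic.positionCDF b) (Icc 0 1) x) ∧
    (∀ b ∈ Icc (0 : ℝ) 1, IntegrableOn (CardCyclic.positionDensity b) (Icc 0 1) ∧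
      ∀ x ∈ Icc (0 : ℝ) 1,
        ∫ t in (0 : ℝ)..x, CardCyclic.positionDensity b t = CardCyclic.positionCDF b x) ∧
    -- `h_x`, with an additional atom at `0` if `x = 0`, is the limiting law of the rescaled number
    -- of the card in a position around `x * n`
    (∀ x ∈ Ioc (0 : ℝ) 1,
      CardCyclic.IsLimitingCardLaw x (CardCyclic.densityMeasure x)) ∧
    CardCyclic.IsLimitingCardLaw 0
      (CardCyclic.densityMeasure 0 + ENNReal.ofReal (Real.exp (-1)) • Measure.dirac 0) ∧
    -- the case `x = 0`
    (∀ b ∈ Ioc (0 : ℝ) 1, CardCyclic.cardDensity 0 b = Real.exp (b - 1)) ∧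
    (∫ b in (0 : ℝ)..1, CardCyclic.cardDensity 0 b = 1 - Real.exp (-1)) ∧
    -- the case `x = 1`
    (∀ b ∈ Ico (0 : ℝ) 1,
      CardCyclic.cardDensity 1 b = Real.exp b / (Real.exp 1 - 1)) ∧
    Tendsto (CardCyclic.cardDensity 1) (𝓝[<] 1) (𝓝 (Real.exp 1 / (Real.exp 1 - 1))) ∧
    -- `b ↦ x_b` is a bijection of `[0, 1)`, so that its inverse `x ↦ b_x` is defined on `[0, 1)`
    BijOn CardCyclic.xOf (Ico 0 1) (Ico 0 1) ∧
    -- the case `0 < x < 1`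
    (∀ x ∈ Ioo (0 : ℝ) 1,
      CardCyclic.cardDensity x 0 =
        Real.exp (CardCyclic.bOf x - 1) / (Real.exp (CardCyclic.bOf x) - 1) ∧
      (StrictMonoOn (CardCyclic.cardDensity x) (Ioo 0 (CardCyclic.bOf x)) ∧
        ConvexOn ℝ (Ioo 0 (CardCyclic.bOf x)) (CardCyclic.cardDensity x)) ∧
      Tendsto (CardCyclic.cardDensity x) (𝓝[<] (CardCyclic.bOf x))
        (𝓝 (Real.exp (CardCyclic.bOf x - 1) / (1 - Real.exp (-CardCyclic.bOf x)))) ∧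
      ∀ b ∈ Ioc (CardCyclic.bOf x) 1, CardCyclic.cardDensity x b = Real.exp (b - 1)) := by
  refine ⟨fun b hb j hjn hj x hx => ?_, fun b hb x hx => CardCyclic.differentiableWithinAt_positionCDF hb hx,
    fun b hb => CardCyclic.integral_positionDensity hb,
    fun x hx => CardCyclic.isLimitingCardLaw_densityMeasure hx,
    CardCyclic.isLimitingCardLaw_zero, fun b hb => CardCyclic.cardDensity_zero_left hb, ?_,
    fun b hb => CardCyclic.cardDensity_one_left hb, CardCyclic.tendsto_cardDensity_one_left,
    CardCyclic.bijOn_xOf, fun x hx => ⟨CardCyclic.cardDensity_zero_right hx,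
      ⟨CardCyclic.strictMonoOn_cardDensity hx, CardCyclic.convexOn_cardDensity hx⟩,
      CardCyclic.tendsto_cardDensity_bOf hx, fun b hb => CardCyclic.cardDensity_of_mem_Ioc hx hb⟩⟩
  · rw [CardCyclic.positionCDF_eq hb hx]
    exact CardCyclic.tendsto_positionProb hb hx hjn hj
  · rw [CardCyclic.integral_cardDensity_zero_left.2 1 (right_mem_Icc.2 zero_le_one), sub_self,
      Real.exp_zero]
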